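/- Let $G=(V,E)$ be a directed graph, loops allowed, on $V=\{1,\dots,n\}$. For $S=\{v_1,\dots,v_m\}\subseteq V$, a system with underlying graph $G$ and input set $S$ is a linear system $\dot x = Ax+Bu$ with $A\in\mathbb{R}^{n\times n}$ such that, for all $i,j$ (including $i=j$), $a_{ij}\neq 0$ if and only if $(j,i)\in E$, and $B\in\mathbb{R}^{n\times m}$ such that $b_{ij}\ne 0$ if and only if $i=v_j$. It is controllable if the controllability matrix $[\,B\ AB\ A^2B\ \cdots\ A^{n-1}B\,]$ has rank $n$. The set $S$ is an input set for strong controllability of $G$ if all systems with underlying graph $G$ and input set $S$ are controllable, and a minimum-size input set if moreover no input set for strong controllability of $G$ has fewer vertices. The graph $G$ is self-damped if it has a loop on each vertex, and it has a tree structure if, after removal of its loops, it is the symmetric directed graph obtained from an undirected tree (on $V$, hence $n \ge 1$) by replacing each edge $\{u,v\}$ by $(u,v)$ and $(v,u)$. **Theorem.** A minimum-size input set for strong controllability of a self-damped system with a tree structure can be computed in polynomial time: there is a deterministic multi-tape Turing machine which, given the adjacency matrix of any self-damped graph $G$ with a tree structure (the rows written one after the other as strings of $n$ bits, each followed by a separator),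 halts after a number of steps bounded by a polynomial in the length of the input, with the indicator vector in $\{0,1\}^n$ of a minimum-size input set for strong controllability of $G$ as its output. -/

import Mathlib

namespace StrongControl

/-- The matrices `A ∈ Q_ld(G)` whose zero-nonzero pattern is given by the loop directed graph `G`:
`a_ij ≠ 0` exactly when there is an edge from `j` to `i`. The diagonal is included. -/
def IsRealization {V : Type*} (G : Digraph V) (A : Matrix V V ℝ) : Prop :=
  ∀ i j, A i j ≠ 0 ↔ G.Adj j i

/-- The matrices `B ∈ 𝐁(S)`: one column per vertex `v` of `S`, and the only nonzero entry
of that column is in row `v`. -/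
def IsInputRealization {V : Type*} (S : Finset V) (B : Matrix V S ℝ) : Prop :=
  ∀ (i : V) (j : S), B i j ≠ 0 ↔ i = (j : V)

/-- The controllability matrix `[B  AB  A²B  ⋯  Aⁿ⁻¹B]` with `n = |V|`; its columns are indexed by
a power `k < n` and a column of `B`. -/
def controllabilityMatrix {V ι : Type*} [Fintype V] [DecidableEq V]
    (A : Matrix V V ℝ) (B : Matrix V ι ℝ) : Matrix V (Fin (Fintype.card V) × ι) ℝ :=
  Matrix.of fun i c => (A ^ (c.1 : ℕ) * B) i c.2

/-- `ẋ = A x + B u` is controllable: the controllability matrix has full (row) rank `n`. -/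
def IsControllable {V ι : Type*} [Fintype V] [DecidableEq V] [Fintype ι]
    (A : Matrix V V ℝ) (B : Matrix V ι ℝ) : Prop :=
  (controllabilityMatrix A B).rank = Fintype.card V

/-- `S` is an input set for strong controllability of the system with underlying loop directed
graph `G`: every system `(A, B)` with `A ∈ Q_ld(G)` and `B ∈ 𝐁(S)` is controllable. -/
def StronglyControllable {V : Type*} [Fintype V] [DecidableEq V]
    (G : Digraph V) (S : Finset V) : Prop :=
  ∀ (A : Matrix V V ℝ) (B : Matrix V S ℝ),
    IsRealization G A → IsInputRealization S B → IsControllable A B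

/-- `S` is a minimum-size input set for strong controllability. -/
def IsMinimumInputSet {V : Type*} [Fintype V] [DecidableEq V]
    (G : Digraph V) (S : Finset V) : Prop :=
  StronglyControllable G S ∧ ∀ T : Finset V, StronglyControllable G T → S.card ≤ T.card

/-- Self-damped: there is a loop on each vertex. -/
def IsSelfDamped {V : Type*} (G : Digraph V) : Prop :=
  ∀ v, G.Adj v v

/-- Tree structure: without its loops, `G` is the (symmetric) directed graph of an undirected
tree. -/
def HasTreeStructure {V : Type*} (G : Digraph V) : Prop :=
  ∃ T : SimpleGraph V, T.IsTree ∧ ∀ u v, u ≠ v → (G.Adj u v ↔ T.Adj u v)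

/-- The instances of the computational problem: the underlying graphs, on `{0, …, n - 1}`, of
self-damped systems with a tree structure. -/
structure SelfDampedTree where
  n : ℕ
  graph : Digraph (Fin n)
  selfDamped : IsSelfDamped graph
  tree : HasTreeStructure graph

open Classical in
/-- The adjacency matrix of a graph as a word: the rows in order, each one as a string of `n` bits
followed by a comma. -/
noncomputable def encodeDigraph {n : ℕ} (G : Digraph (Fin n)) : List Computability.Γ' :=
  (List.finRange n).flatMap fun i =>
    (List.finRange n).map (fun j => Computability.Γ'.bit (decide (G.Adj i j))) ++
      [Computability.Γ'.comma]

/-- The input word of an instance. -/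
noncomputable def encodeInstance (I : SelfDampedTree) : List Computability.Γ' :=
  encodeDigraph I.graph

/-- A subset of `{0, …, n - 1}` as its indicator word of `n` bits. -/
def encodeVertexSet (S : Σ n : ℕ, Finset (Fin n)) : List Bool :=
  (List.finRange S.1).map fun i => decide (i ∈ S.2)

/-- `f` is computed by a (multi-stack) Turing machine, all of whose stack alphabets are finite,
in a number of steps bounded by a polynomial in the length of the input word. -/
def PolyTimeComputable {α β Γ₀ Γ₁ : Type} (ea : α → List Γ₀) (eb : β → List Γ₁)
    (f : α → β) : Prop :=
  ∃ M : Turing.TM2ComputableInPolyTime ea eb f, ∀ k : M.tm.K, Finite (M.tm.Γ k)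

end StrongControl

/-! With a loop at every vertex, strong controllability amounts to zero forcing: a blue vertex with
exactly one non-blue out-neighbour (loops disregarded) colours it blue, and `S` is an input set if
and only if all vertices become blue. If `S` forces and the row vector `w` annihilates the
controllability matrix, then every `w A^k` vanishes on `S`, and the zeros spread along the forces
(`stronglyControllable_of_isForcingSet`). If `S` does not force, the entries can be chosen so that
the indicator of the vertices never coloured is a left eigenvector of `A` that `B` does not see
(`isForcingSet_of_stronglyControllable`).

On a tree, a smallest forcing set comes from a greedy cover by paths. Vertices with at most one
remaining neighbour are eliminated one at a time. An eliminated vertex starts a path (tail) if none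
of its neighbours is the open end of a path, prolongs a path (inner) if exactly one is, and
otherwise joins two paths (joint) and is no longer open. One of the two paths at a joint is turned
downwards, so the combined path climbs from a tail to the joint and descends to another tail. The
tails not turned form `S`. The ascending parts force in the order of elimination, then the
descending parts in the reverse order (`IsEliminationCertificate.isForcingSet`).

Minimality is a count. For any forcing set `T`, each vertex outside `T` is forced across an edge. A
joint forces at most once and is forced at most once, and an edge without joints can be charged to
its later end, which has exactly one open child. Hence `Tᶜ` has at most `2 * #joints + #inner`
elements (`card_compl_le`), and the complement of `S` has at least as many (`le_card_compl`).

A machine with five stacks computes the marks by repeated passes through the matrix. Each pass with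
a change lowers a weight that is `3 * n` at the start, and a pass takes time linear in the input. A
pass without change leaves a valid certificate (`EliminationInvariant.isMinimumInputSet`). -/

namespace StrongControl

/-! ### Strong controllability and zero forcing. -/

section ZeroForcing

variable {V : Type*}

/-- The closure of `S` under the colour change rule: a blue vertex all of whose out-neighbours
but one (loops disregarded) are blue forces the remaining one. -/
inductive Forced (G : Digraph V) (S : Finset V) : V → Prop
  | base {v : V} : v ∈ S → Forced G S v
  | force {u v : V} : Forced G S u → G.Adj u v → u ≠ v →
      (∀ w, G.Adj u w → w ≠ u → w ≠ v → Forced G S w) → Forced G S v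

/-- `S` is a zero forcing set of `G`. -/
def IsForcingSet (G : Digraph V) (S : Finset V) : Prop := ∀ v, Forced G S v

theorem rank_eq_card_of_vecMul_injective {m n : Type*} [Fintype m] [Fintype n]
    (C : Matrix m n ℝ) (h : ∀ w, Matrix.vecMul w C = 0 → w = 0) : C.rank = Fintype.card m := by
  have : LinearIndependent ℝ C.row := by
    rw [← Matrix.vecMul_injective_iff]
    intro x y hxy
    have := h (x - y) (by rw [Matrix.sub_vecMul]; exact sub_eq_zero.2 hxy)
    exact sub_eq_zero.1 this
  exact this.rank_matrix

theorem vecMul_injective_of_rank_eq_card {m n : Type*} [Fintype m] [Fintype n]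
    (C : Matrix m n ℝ) (h : C.rank = Fintype.card m) {w : m → ℝ}
    (hw : Matrix.vecMul w C = 0) : w = 0 := by
  have h1 : LinearIndependent ℝ C.row := by
    rw [linearIndependent_iff_card_eq_finrank_span, ← h, Matrix.rank_eq_finrank_span_row]
    rfl
  rw [← Matrix.vecMul_injective_iff] at h1
  exact h1 (by simpa using hw)

variable [Fintype V] [DecidableEq V]

theorem vecMul_controllabilityMatrix_apply {ι : Type*} (A : Matrix V V ℝ)
    (B : Matrix V ι ℝ) (w : V → ℝ) (c : Fin (Fintype.card V) × ι) :
    Matrix.vecMul w (controllabilityMatrix A B) c =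
      Matrix.vecMul (Matrix.vecMul w (A ^ (c.1 : ℕ))) B c.2 := by
  rw [Matrix.vecMul_vecMul]
  rfl

/-- Cayley–Hamilton: every power of `A` is a combination of the powers below `|V|`. -/
theorem vecMul_pow_vecMul_eq_zero {ι : Type*} (A : Matrix V V ℝ) (B : Matrix V ι ℝ) (w : V → ℝ)
    (h : ∀ k < Fintype.card V, Matrix.vecMul (Matrix.vecMul w (A ^ k)) B = 0) (k : ℕ) :
    Matrix.vecMul (Matrix.vecMul w (A ^ k)) B = 0 := by
  rw [Matrix.pow_eq_aeval_mod_charpoly A k]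
  set p := (Polynomial.X ^ k %ₘ A.charpoly : Polynomial ℝ)
  -- If `V` is empty, no degree is below `|V| = 0`, so this case is separate.
  cases isEmpty_or_nonempty V with
  | inl _ =>
    ext j
    simp [Matrix.vecMul, dotProduct]
  | inr _ =>
    have hdeg : p.natDegree < Fintype.card V := by
      rw [← A.charpoly_natDegree_eq_dim]
      refine Polynomial.natDegree_modByMonic_lt _ A.charpoly_monic ?_
      intro h1
      have h2 := A.charpoly_natDegree_eq_dim
      rw [h1, Polynomial.natDegree_one] at h2
      exact Fintype.card_ne_zero h2.symm
    rw [Polynomial.aeval_eq_sum_range' hdeg, Matrix.vecMul_vecMul, Matrix.sum_mul,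
      Matrix.vecMul_sum]
    refine Finset.sum_eq_zero fun i hi => ?_
    rw [Matrix.smul_mul, Matrix.vecMul_smul, ← Matrix.vecMul_vecMul, h i (Finset.mem_range.1 hi),
      smul_zero]

/-- If `w A^k` vanishes for all `k` at `u` and at all out-neighbours of `u` but `v`, then entry `u`
of `w A^(k+1)` reduces to entry `v` of `w A^k` times `A v u ≠ 0`. So the zeros follow the forces. -/
theorem stronglyControllable_of_isForcingSet {G : Digraph V} {S : Finset V}
    (h : IsForcingSet G S) : StronglyControllable G S := by
  intro A B hA hB
  refine rank_eq_card_of_vecMul_injective _ fun w hw => ?_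
  have h0 : ∀ k, Matrix.vecMul (Matrix.vecMul w (A ^ k)) B = 0 := by
    refine vecMul_pow_vecMul_eq_zero A B w fun k hk => ?_
    ext j
    have := congrFun hw (⟨k, hk⟩, j)
    rwa [vecMul_controllabilityMatrix_apply] at this
  have hS : ∀ k, ∀ v ∈ S, Matrix.vecMul w (A ^ k) v = 0 := by
    intro k v hv
    have h1 := congrFun (h0 k) ⟨v, hv⟩
    have h2 : ∀ i, i ≠ v → B i ⟨v, hv⟩ = 0 := fun i hi => by
      by_contra h3
      exact hi ((hB i ⟨v, hv⟩).1 h3)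
    rw [Matrix.vecMul, dotProduct, Finset.sum_eq_single v] at h1
    · exact (mul_eq_zero.1 h1).resolve_right ((hB v ⟨v, hv⟩).2 rfl)
    · intro i _ hi
      rw [h2 i hi, mul_zero]
    · simp
  have hall : ∀ v, Forced G S v → ∀ k, Matrix.vecMul w (A ^ k) v = 0 := by
    intro v hv
    induction hv with
    | base hv => exact fun k => hS k _ hv
    | @force u v _ huv hne _ ihu ih =>
      intro k
      have h1 := ihu (k + 1)
      rw [pow_succ, ← Matrix.vecMul_vecMul, Matrix.vecMul, dotProduct, Finset.sum_eq_single v] at h1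
      · exact (mul_eq_zero.1 h1).resolve_right ((hA v u).2 huv)
      · intro i _ hi
        by_cases hiu : i = u
        · rw [hiu, ihu k, zero_mul]
        · by_cases hadj : G.Adj u i
          · rw [ih i hadj hiu hi k, zero_mul]
          · rw [not_not.1 (mt (hA i u).1 hadj), mul_zero]
      · simp
  ext v
  simpa using hall v (h v) 0

-- Let `w` be the indicator of the vertices never forced. A forced vertex never has exactly one
-- unforced out-neighbour, so nonzero entries with sum zero fit into its column. At an unforced
-- vertex, the loop adjusts the column sum to a common eigenvalue. Then `w` is a nonzero left
-- eigenvector of `A` with `w B = 0`.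
open Classical in
theorem isForcingSet_of_stronglyControllable {G : Digraph V} {S : Finset V}
    (hd : IsSelfDamped G) (h : StronglyControllable G S) : IsForcingSet G S := by
  by_contra hS
  obtain ⟨z, hz⟩ := not_forall.1 hS
  let N : V → Finset V := fun j => {i | ¬ Forced G S i ∧ i ≠ j ∧ G.Adj j i}
  have hN : ∀ j, Forced G S j → (N j).card ≠ 1 := by
    intro j hj hc
    obtain ⟨i, hi⟩ := Finset.card_eq_one.1 hc
    have him : i ∈ N j := by simp [hi]
    simp only [N, Finset.mem_filter, Finset.mem_univ, true_and] at him
    refine him.1 (Forced.force hj him.2.2 him.2.1.symm fun w hw hwj hwi => ?_)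
    by_contra hwF
    have : w ∈ N j := by simp [N, hwF, hwj, hw]
    rw [hi, Finset.mem_singleton] at this
    exact hwi this
  have hch : ∀ j, ∃ c, (N j).Nonempty → c ∈ N j := by
    intro j
    by_cases hne : (N j).Nonempty
    · exact ⟨hne.choose, fun _ => hne.choose_spec⟩
    · exact ⟨j, fun h => absurd h hne⟩
  choose c hc using hch
  -- Larger than every `(N j).card`, so that the diagonal entries `lam - (N j).card` are nonzero.
  let lam : ℝ := Fintype.card V + 1
  -- In a forced column, the entry at the chosen `c j` balances the ones at the rest of `N j`; in an
  -- unforced column, the diagonal entry completes the sum to `lam`.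
  let A : Matrix V V ℝ := fun i j =>
    if ¬ G.Adj j i then 0
    else if i = j then (if Forced G S j then 1 else lam - (N j).card)
    else if Forced G S j ∧ i = c j then 1 - (N j).card else 1
  have hlam : ∀ j, lam - ((N j).card : ℝ) ≠ 0 := by
    intro j
    have : ((N j).card : ℝ) ≤ Fintype.card V := by exact_mod_cast Finset.card_le_univ _
    simp only [lam]
    linarith
  have hA : IsRealization G A := by
    intro i j
    by_cases hadj : G.Adj j i
    · simp only [A, hadj, not_true_eq_false, if_false, iff_true]
      split_ifs with h1 h2 h3
      · exact one_ne_zero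
      · exact hlam j
      · have := hN j h3.1
        rw [sub_ne_zero]
        exact_mod_cast this.symm
      · exact one_ne_zero
    · simp [A, hadj]
  let B : Matrix V S ℝ := fun i j => if i = (j : V) then 1 else 0
  have hB : IsInputRealization S B := by
    intro i j
    simp [B]
  let w : V → ℝ := fun i => if Forced G S i then 0 else 1
  have hwA : Matrix.vecMul w A = lam • w := by
    ext j
    have e : Matrix.vecMul w A j = w j * A j j + ∑ i ∈ N j, A i j := by
      rw [Matrix.vecMul, dotProduct, ← Finset.add_sum_erase _ _ (Finset.mem_univ j)]
      congr 1
      symm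
      apply Finset.sum_subset_zero_on_sdiff
      · intro i hi
        simp only [N, Finset.mem_filter, Finset.mem_univ, true_and] at hi
        simp [hi.2.1]
      · intro i hi
        simp only [N, Finset.mem_sdiff, Finset.mem_erase, Finset.mem_filter, Finset.mem_univ,
          true_and, and_true] at hi
        by_cases h1 : Forced G S i
        · simp [w, h1]
        · have : ¬ G.Adj j i := fun h2 => hi.2 ⟨h1, hi.1, h2⟩
          simp [A, this]
      · intro i hi
        simp only [N, Finset.mem_filter, Finset.mem_univ, true_and] at hi
        simp [w, hi.1]
    have hAN : ∀ i ∈ N j, A i j = if Forced G S j ∧ i = c j then 1 - ((N j).card : ℝ) else 1 := by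
      intro i hi
      simp only [N, Finset.mem_filter, Finset.mem_univ, true_and] at hi
      simp [A, hi.2.1, hi.2.2]
    rw [e, Finset.sum_congr rfl hAN]
    by_cases hj : Forced G S j
    · simp only [w, hj, if_true, zero_mul, zero_add, true_and, Pi.smul_apply, smul_zero]
      rcases (N j).eq_empty_or_nonempty with h0 | h0
      · simp [h0]
      · rw [← Finset.add_sum_erase _ _ (hc j h0), Finset.sum_congr rfl
          (g := fun _ => (1 : ℝ)) (fun i hi => if_neg (Finset.ne_of_mem_erase hi))]
        simp only [if_true, Finset.sum_const, nsmul_eq_mul, mul_one]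
        rw [Finset.card_erase_of_mem (hc j h0), Nat.cast_sub (Finset.card_pos.2 h0)]
        simp
    · simp [w, hj, A, hd j]
  have hwk : ∀ k : ℕ, Matrix.vecMul w (A ^ k) = lam ^ k • w := by
    intro k
    induction k with
    | zero => simp
    | succ k ih =>
      rw [pow_succ, ← Matrix.vecMul_vecMul, ih, Matrix.smul_vecMul, hwA, smul_smul, pow_succ]
  have hw0 : w = 0 := by
    refine vecMul_injective_of_rank_eq_card _ (h A B hA hB) ?_
    ext c
    rw [vecMul_controllabilityMatrix_apply, hwk]
    have : Matrix.vecMul w B = 0 := by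
      ext j
      simp [Matrix.vecMul, dotProduct, B, w, Forced.base j.2]
    rw [Matrix.smul_vecMul, this]
    simp
  have := congrFun hw0 z
  simp [w, hz] at this

end ZeroForcing

/-- The end of a longest path inside `U` works: in a forest, a second neighbour in `U` would prolong
the path. This keeps the elimination from getting stuck. -/
theorem exists_mem_forall_adj_eq_of_isAcyclic {V : Type*} [Finite V]
    {T : SimpleGraph V} (hT : T.IsAcyclic) (U : Set V) (hU : U.Nonempty) :
    ∃ v ∈ U, ∀ a ∈ U, ∀ b ∈ U, T.Adj v a → T.Adj v b → a = b := by
  have : Nonempty U := hU.to_subtype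
  obtain ⟨u, v, p, hp, hmax⟩ :=
    SimpleGraph.Walk.exists_isPath_forall_isPath_length_le_length (T.induce U)
  have key : ∀ w, (T.induce U).Adj u w → w = p.snd := by
    intro w hw
    refine (hT.induce U).eq_snd_of_adj_start hp hw ?_
    by_contra hmem
    have := hmax _ _ (SimpleGraph.Walk.cons hw.symm p)
      ((SimpleGraph.Walk.cons_isPath_iff _ _).2 ⟨hp, hmem⟩)
    simp at this
  refine ⟨u, u.2, fun a ha b hb hua hub => ?_⟩
  have h1 := key ⟨a, ha⟩ hua
  have h2 := key ⟨b, hb⟩ hub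
  exact congrArg Subtype.val (h1.trans h2.symm)

/-! ### Elimination certificates: forcing and optimality. -/

section Certificate

variable {V : Type*}

/-- Adjacency, loops disregarded. -/
def Nbr (G : Digraph V) (u v : V) : Prop := G.Adj u v ∧ u ≠ v

/-- A neighbour `c` of `v` that precedes it and is the upper end of a path before `v` is added. -/
def OpenChild (G : Digraph V) (t k : V → ℕ) (c v : V) : Prop :=
  Nbr G c v ∧ t c < t v ∧ k c ≤ 1

/-- An elimination order `t` of a symmetric forest with the number `k` of open children of each
vertex, capped at two, and the set `D` of the vertices whose path is traversed downwards. -/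
structure IsEliminationCertificate (G : Digraph V) (t k : V → ℕ) (D : V → Prop) : Prop where
  symm : ∀ u v, Nbr G u v → Nbr G v u
  time_ne : ∀ u v, Nbr G u v → t u ≠ t v
  parent_unique : ∀ v a b, Nbr G v a → Nbr G v b → t v < t a → t v < t b → a = b
  le_two : ∀ v, k v ≤ 2
  of_zero : ∀ v c, k v = 0 → ¬ OpenChild G t k c v
  of_one : ∀ v, k v = 1 → ∃ c, OpenChild G t k c v ∧ (D c ↔ D v) ∧
    ∀ c', OpenChild G t k c' v → c' = c
  of_two : ∀ v, k v = 2 → ∃ c, OpenChild G t k c v ∧ D c ∧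
    (∀ c', OpenChild G t k c' v → D c' → c' = c) ∧ ∃ c', OpenChild G t k c' v ∧ c' ≠ c
  down_le : ∀ v, D v → k v ≤ 1
  down_parent : ∀ v, D v → ∃ p, Nbr G v p ∧ t v < t p

variable {G : Digraph V} {t k : V → ℕ} {D : V → Prop}

/-- Induction on time: a vertex that is not down and not in `S` has an open child that is not down,
and this child forces it. -/
theorem IsEliminationCertificate.forced_of_not_down (h : IsEliminationCertificate G t k D)
    {S : Finset V} (hS : ∀ v, v ∈ S ↔ k v = 0 ∧ ¬ D v) :
    ∀ m v, t v = m → ¬ D v → Forced G S v := by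
  intro m
  induction m using Nat.strong_induction_on with
  | _ m ih =>
    intro v hv hD
    -- All other neighbours of `c` are earlier than `c`. One that is down would be the only open
    -- child of `c`, which would make `c` down too.
    have up : ∀ c, OpenChild G t k c v → ¬ D c → Forced G S v := by
      intro c hc hcD
      refine Forced.force (ih (t c) (hv ▸ hc.2.1) c rfl hcD) hc.1.1 hc.1.2 fun w hw hwc hwv => ?_
      have hcw : Nbr G c w := ⟨hw, hwc.symm⟩
      have hlt : t w < t c := by
        rcases lt_trichotomy (t w) (t c) with h1 | h1 | h1
        · exact h1
        · exact absurd h1.symm (h.time_ne _ _ hcw)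
        · exact absurd (h.parent_unique c w v hcw hc.1 h1 hc.2.1) hwv
      refine ih (t w) (hv ▸ hlt.trans hc.2.1) w rfl fun hwD => ?_
      have hop : OpenChild G t k w c := ⟨h.symm _ _ hcw, hlt, h.down_le w hwD⟩
      have hk : k c = 1 := by
        have h1 := hc.2.2
        have h2 : k c ≠ 0 := fun h0 => h.of_zero c w h0 hop
        omega
      obtain ⟨c', _, h2, h3⟩ := h.of_one c hk
      rw [← h3 w hop] at h2
      exact hcD (h2.1 hwD)
    have hk := h.le_two v
    interval_cases hkv : k v
    · exact Forced.base ((hS v).2 ⟨hkv, hD⟩)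
    · obtain ⟨c, hc, h2, _⟩ := h.of_one v hkv
      exact up c hc (fun h1 => hD (h2.1 h1))
    · obtain ⟨c, _, _, h2, c', hc', hne⟩ := h.of_two v hkv
      exact up c' hc' (fun h1 => hne (h2 c' hc' h1))

/-- Once the other vertices are blue, each down vertex is forced by its parent, later ones first. A
parent has at most one down child, so its remaining neighbours are blue by then. -/
theorem IsEliminationCertificate.isForcingSet [Finite V] (h : IsEliminationCertificate G t k D)
    {S : Finset V} (hS : ∀ v, v ∈ S ↔ k v = 0 ∧ ¬ D v) : IsForcingSet G S := by
  have hup : ∀ v, ¬ D v → Forced G S v := fun v => h.forced_of_not_down hS _ v rfl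
  obtain ⟨N, hN⟩ : ∃ N, ∀ v, t v ≤ N := by
    obtain ⟨N, hN⟩ := (Set.finite_range t).bddAbove
    exact ⟨N, fun v => hN ⟨v, rfl⟩⟩
  suffices hdown : ∀ m v, N - t v = m → D v → Forced G S v by
    intro v
    by_cases hv : D v
    · exact hdown _ v rfl hv
    · exact hup v hv
  intro m
  induction m using Nat.strong_induction_on with
  | _ m ih =>
    intro v hv hD
    have later : ∀ p, t v < t p → Forced G S p := by
      intro p hp
      by_cases hpD : D p
      · exact ih (N - t p) (by have := hN p; omega) p rfl hpD
      · exact hup p hpD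
    obtain ⟨p, hvp, hlt⟩ := h.down_parent v hD
    have hpv := h.symm _ _ hvp
    refine Forced.force (later p hlt) hpv.1 hpv.2 fun w hw hwp hwv => ?_
    have hpw : Nbr G p w := ⟨hw, hwp.symm⟩
    rcases lt_trichotomy (t w) (t p) with h1 | h1 | h1
    · refine hup w fun hwD => hwv ?_
      have hw' : OpenChild G t k w p := ⟨h.symm _ _ hpw, h1, h.down_le w hwD⟩
      have hv' : OpenChild G t k v p := ⟨hvp, hlt, h.down_le v hD⟩
      have hk := h.le_two p
      interval_cases hkp : k p
      · exact absurd hw' (h.of_zero p w hkp)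
      · obtain ⟨c, _, _, h3⟩ := h.of_one p hkp
        rw [h3 w hw', h3 v hv']
      · obtain ⟨c, _, _, h3, _⟩ := h.of_two p hkp
        rw [h3 w hw' hwD, h3 v hv' hD]
    · exact absurd h1.symm (h.time_ne _ _ hpw)
    · exact later w (hlt.trans h1)

/-- The forces of a zero forcing set: each vertex outside of it is forced by a neighbour, no
vertex forces twice, and no two vertices force each other. -/
theorem IsForcingSet.exists_forces [Fintype V] [DecidableEq V] {T : Finset V}
    (hT : IsForcingSet G T) : ∃ f : V → V, (∀ w ∉ T, Nbr G (f w) w) ∧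
      (∀ w ∉ T, ∀ w' ∉ T, f w = f w' → w = w') ∧
      ∀ w ∉ T, ∀ w' ∉ T, f w = w' → f w' = w → False := by
  -- The blue set `B` grows by one force at a time. All out-neighbours of a vertex that has forced
  -- are in `B`, so it cannot force again; a vertex outside `B` has not forced yet.
  suffices hgrow : ∀ m, ∀ B : Finset V, T ⊆ B → Bᶜ.card = m → ∀ f : V → V,
      (∀ w ∈ B, w ∉ T → Nbr G (f w) w ∧ f w ∈ B ∧ ∀ x, G.Adj (f w) x → x ∈ B) →
      (∀ w ∈ B, w ∉ T → ∀ w' ∈ B, w' ∉ T → f w = f w' → w = w') →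
      (∀ w ∈ B, w ∉ T → ∀ w' ∈ B, w' ∉ T → f w = w' → f w' = w → False) →
      ∃ f : V → V, (∀ w ∉ T, Nbr G (f w) w) ∧
      (∀ w ∉ T, ∀ w' ∉ T, f w = f w' → w = w') ∧
      ∀ w ∉ T, ∀ w' ∉ T, f w = w' → f w' = w → False by
    refine hgrow _ T subset_rfl rfl id ?_ ?_ ?_
    all_goals exact fun w h1 h2 => absurd h1 h2
  intro m
  induction m with
  | zero =>
    intro B _ hm f h1 h2 h3
    have hB : ∀ w, w ∈ B := by
      rw [Finset.card_eq_zero, Finset.compl_eq_empty_iff] at hm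
      simp [hm]
    exact ⟨f, fun w hw => (h1 w (hB w) hw).1, fun w hw w' hw' => h2 w (hB w) hw w' (hB w') hw',
      fun w hw w' hw' => h3 w (hB w) hw w' (hB w') hw'⟩
  | succ m ih =>
    intro B hTB hm f h1 h2 h3
    -- Otherwise `B` would be closed under forcing and hence everything.
    obtain ⟨u, hu, v, hv, huv, hne, hall⟩ : ∃ u ∈ B, ∃ v ∉ B, G.Adj u v ∧ u ≠ v ∧
        ∀ w, G.Adj u w → w ≠ v → w ∈ B := by
      by_contra hcon
      push Not at hcon
      have hsub : ∀ v, Forced G T v → v ∈ B := by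
        intro v hv
        induction hv with
        | base hv => exact hTB hv
        | @force u v _ huv hne _ ihu ihw =>
          by_contra hvB
          obtain ⟨w, hw1, hw2, hw3⟩ := hcon u ihu v hvB huv hne
          by_cases hwu : w = u
          · exact hw3 (hwu ▸ ihu)
          · exact hw3 (ihw w hw1 hwu hw2)
      have : B = Finset.univ := Finset.eq_univ_of_forall fun v => hsub v (hT v)
      simp [this] at hm
    have hfB : ∀ w ∈ B, w ∉ T → f w ∈ B := fun w hw hwT => (h1 w hw hwT).2.1
    have hfu : ∀ w ∈ B, w ∉ T → f w ≠ u := fun w hw hwT he =>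
      hv ((h1 w hw hwT).2.2 v (he ▸ huv))
    have hupd : ∀ w ∈ B, Function.update f v u w = f w := fun w hw =>
      Function.update_of_ne (by rintro rfl; exact hv hw) _ _
    have hupv : Function.update f v u v = u := Function.update_self _ _ _
    refine ih (insert v B) (hTB.trans (Finset.subset_insert _ _)) ?_
      (Function.update f v u) ?_ ?_ ?_
    · have e1 := Finset.card_compl B
      have e2 := Finset.card_compl (insert v B)
      rw [Finset.card_insert_of_notMem hv] at e2
      omega
    · intro w hw hwT
      rcases Finset.mem_insert.1 hw with rfl | hwB
      · rw [hupv]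
        refine ⟨⟨huv, hne⟩, Finset.mem_insert_of_mem hu, fun x hx => ?_⟩
        by_cases hxw : x = w
        · simp [hxw]
        · exact Finset.mem_insert_of_mem (hall x hx hxw)
      · rw [hupd w hwB]
        obtain ⟨a, b, c⟩ := h1 w hwB hwT
        exact ⟨a, Finset.mem_insert_of_mem b, fun x hx => Finset.mem_insert_of_mem (c x hx)⟩
    · intro w hw hwT w' hw' hwT'
      rcases Finset.mem_insert.1 hw with rfl | hwB <;>
        rcases Finset.mem_insert.1 hw' with rfl | hwB'
      · exact fun _ => rfl
      · rw [hupv, hupd w' hwB']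
        exact fun he => absurd he.symm (hfu w' hwB' hwT')
      · rw [hupv, hupd w hwB]
        exact fun he => absurd he (hfu w hwB hwT)
      · rw [hupd w hwB, hupd w' hwB']
        exact h2 w hwB hwT w' hwB' hwT'
    · intro w hw hwT w' hw' hwT'
      rcases Finset.mem_insert.1 hw with rfl | hwB <;>
        rcases Finset.mem_insert.1 hw' with rfl | hwB'
      · rw [hupv]
        exact fun he _ => hne he
      · rw [hupv, hupd w' hwB']
        exact fun _ he => hv (he ▸ hfB w' hwB' hwT')
      · rw [hupv, hupd w hwB]
        exact fun he _ => hv (he ▸ hfB w hwB hwT)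
      · rw [hupd w hwB, hupd w' hwB']
        exact h3 w hwB hwT w' hwB' hwT'

-- Each vertex `w` outside `T` is itself a joint, or has a joint as its forcer `f w`, or its forcing
-- edge avoids joints. The first two classes have at most `#Q` elements each, since `f` is
-- injective.
open Classical in
theorem IsEliminationCertificate.card_compl_le [Fintype V]
    (h : IsEliminationCertificate G t k D) {T : Finset V} (hT : IsForcingSet G T) :
    Tᶜ.card ≤ 2 * (Finset.univ.filter fun v => k v = 2).card +
      (Finset.univ.filter fun v => k v = 1).card := by
  obtain ⟨f, hf1, hf2, hf3⟩ := hT.exists_forces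
  set Q := Finset.univ.filter fun v => k v = 2
  set K := Finset.univ.filter fun v => k v = 1
  have hsub : Tᶜ ⊆ (Q ∪ (Tᶜ.filter fun w => f w ∈ Q)) ∪
      (Tᶜ.filter fun w => w ∉ Q ∧ f w ∉ Q) := by
    intro w hw
    simp only [Finset.mem_union, Finset.mem_filter, hw, true_and]
    tauto
  have hA : (Tᶜ.filter fun w => f w ∈ Q).card ≤ Q.card := by
    refine Finset.card_le_card_of_injOn f (fun w hw => (Finset.mem_filter.1 hw).2) ?_
    intro w hw w' hw' he
    rw [Finset.mem_coe, Finset.mem_filter, Finset.mem_compl] at hw hw'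
    exact hf2 w hw.1 w' hw'.1 he
  have hB : (Tᶜ.filter fun w => w ∉ Q ∧ f w ∉ Q).card ≤ K.card := by
    have hone : ∀ a b, Nbr G a b → t a < t b → a ∉ Q → b ∉ Q → OpenChild G t k a b ∧ k b = 1 := by
      intro a b hab hlt ha hb
      simp only [Q, Finset.mem_filter, Finset.mem_univ, true_and] at ha hb
      have h1 := h.le_two a
      have h2 := h.le_two b
      have hop : OpenChild G t k a b := ⟨hab, hlt, by omega⟩
      have h3 : k b ≠ 0 := fun h0 => h.of_zero b a h0 hop
      exact ⟨hop, by omega⟩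
    have huniq : ∀ a a' b, OpenChild G t k a b → OpenChild G t k a' b → k b = 1 → a = a' := by
      intro a a' b ha ha' hb
      obtain ⟨c, _, _, h3⟩ := h.of_one b hb
      rw [h3 a ha, h3 a' ha']
    -- The edge is charged to its later end, which has a single open child, so the end determines
    -- the edge. Two forces along one edge in the same direction coincide; opposite ones are
    -- excluded by `hf3`.
    refine Finset.card_le_card_of_injOn (fun w => if t w < t (f w) then f w else w) ?_ ?_
    · intro w hw
      rw [Finset.mem_coe, Finset.mem_filter, Finset.mem_compl] at hw
      have hn := hf1 w hw.1
      simp only [K, Finset.coe_filter, Finset.mem_univ, true_and, Set.mem_ofPred_eq]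
      split_ifs with hlt
      · exact (hone w (f w) (h.symm _ _ hn) hlt hw.2.1 hw.2.2).2
      · have := h.time_ne _ _ hn
        exact (hone (f w) w hn (by omega) hw.2.2 hw.2.1).2
    · intro w hw w' hw' he
      rw [Finset.mem_coe, Finset.mem_filter, Finset.mem_compl] at hw hw'
      have hn := hf1 w hw.1
      have hn' := hf1 w' hw'.1
      have hne := h.time_ne _ _ hn
      have hne' := h.time_ne _ _ hn'
      dsimp only at he
      split_ifs at he with h1 h2 h2
      · exact hf2 w hw.1 w' hw'.1 he
      · obtain ⟨a1, a2⟩ := hone w (f w) (h.symm _ _ hn) h1 hw.2.1 hw.2.2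
        obtain ⟨b1, _⟩ := hone (f w') w' hn' (by omega) hw'.2.2 hw'.2.1
        exact (hf3 w hw.1 w' hw'.1 he (huniq _ _ _ (he ▸ b1) a1 a2)).elim
      · obtain ⟨a1, a2⟩ := hone (f w) w hn (by omega) hw.2.2 hw.2.1
        obtain ⟨b1, _⟩ := hone w' (f w') (h.symm _ _ hn') h2 hw'.2.1 hw'.2.2
        exact (hf3 w hw.1 w' hw'.1 (huniq _ _ _ a1 (he ▸ b1) a2) he.symm).elim
      · exact he
  calc Tᶜ.card ≤ _ := Finset.card_le_card hsub
    _ ≤ _ := Finset.card_union_le _ _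
    _ ≤ _ := add_le_add_left (Finset.card_union_le _ _) _
    _ ≤ _ := by omega

-- Every joint and every inner down vertex has a down child, and children of distinct vertices are
-- distinct. Since down vertices are inner or tails, there are at least as many down tails as
-- joints, and these tails are missing from `S`.
open Classical in
theorem IsEliminationCertificate.le_card_compl [Fintype V]
    (h : IsEliminationCertificate G t k D)
    {S : Finset V} (hS : ∀ v, v ∈ S ↔ k v = 0 ∧ ¬ D v) :
    2 * (Finset.univ.filter fun v => k v = 2).card +
      (Finset.univ.filter fun v => k v = 1).card ≤ Sᶜ.card := by
  have hch : ∀ v, ∃ c, (k v = 2 ∨ (k v = 1 ∧ D v)) → OpenChild G t k c v ∧ D c := by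
    intro v
    by_cases h1 : k v = 2
    · obtain ⟨c, hc, hD, _⟩ := h.of_two v h1
      exact ⟨c, fun _ => ⟨hc, hD⟩⟩
    · by_cases h2 : k v = 1 ∧ D v
      · obtain ⟨c, hc, hD, _⟩ := h.of_one v h2.1
        exact ⟨c, fun _ => ⟨hc, hD.2 h2.2⟩⟩
      · exact ⟨v, fun h3 => (h3.elim h1 h2).elim⟩
  choose g hg using hch
  have e1 : (Finset.univ.filter fun v => k v = 2 ∨ (k v = 1 ∧ D v)).card ≤
      (Finset.univ.filter D).card := by
    refine Finset.card_le_card_of_injOn g ?_ ?_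
    · intro v hv
      simp only [Finset.coe_filter, Finset.mem_univ, true_and, Set.mem_ofPred_eq] at hv ⊢
      exact (hg v hv).2
    · intro v hv w hw he
      simp only [Finset.coe_filter, Finset.mem_univ, true_and, Set.mem_ofPred_eq] at hv hw
      have a := (hg v hv).1
      have b := (hg w hw).1
      rw [← he] at b
      exact h.parent_unique _ _ _ a.1 b.1 a.2.1 b.2.1
  have e2 : (Finset.univ.filter fun v => k v = 2 ∨ (k v = 1 ∧ D v)).card =
      (Finset.univ.filter fun v => k v = 2).card +
        (Finset.univ.filter fun v => k v = 1 ∧ D v).card := by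
    rw [Finset.filter_or, Finset.card_union_of_disjoint]
    rw [Finset.disjoint_filter]
    intro v _ h1 h2
    omega
  have e3 : (Finset.univ.filter D).card = (Finset.univ.filter fun v => k v = 1 ∧ D v).card +
      (Finset.univ.filter fun v => k v = 0 ∧ D v).card := by
    rw [← Finset.card_union_of_disjoint, ← Finset.filter_or]
    · congr 1
      ext v
      have := h.down_le v
      simp only [Finset.mem_filter, Finset.mem_univ, true_and]
      constructor
      · intro hD
        have := this hD
        have : k v = 1 ∨ k v = 0 := by omega
        tauto
      · tauto
    · rw [Finset.disjoint_filter]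
      intro v _ h1 h2
      omega
  have e4 : Sᶜ.card = (Finset.univ.filter fun v => k v = 2).card +
      (Finset.univ.filter fun v => k v = 1).card +
      (Finset.univ.filter fun v => k v = 0 ∧ D v).card := by
    rw [← Finset.card_union_of_disjoint, ← Finset.card_union_of_disjoint, ← Finset.filter_or,
      ← Finset.filter_or]
    · congr 1
      ext v
      have h2 := h.le_two v
      have : k v = 2 ∨ k v = 1 ∨ k v = 0 := by omega
      simp only [Finset.mem_compl, hS, Finset.mem_filter, Finset.mem_univ, true_and]
      rcases this with h1 | h1 | h1 <;> simp [h1]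
    · rw [← Finset.filter_or, Finset.disjoint_filter]
      intro v _ h1 h2
      omega
    · rw [Finset.disjoint_filter]
      intro v _ h1 h2
      omega
  omega

theorem IsEliminationCertificate.card_le [Fintype V]
    (h : IsEliminationCertificate G t k D)
    {S : Finset V} (hS : ∀ v, v ∈ S ↔ k v = 0 ∧ ¬ D v) {T : Finset V} (hT : IsForcingSet G T) :
    S.card ≤ T.card := by
  classical
  have e1 := h.card_compl_le hT
  have e2 := h.le_card_compl hS
  have e3 := Finset.card_compl_add_card S
  have e4 := Finset.card_compl_add_card T
  omega

end Certificate

/-- The marks of the vertices during the elimination. A vertex is `unseen` until at most one of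
its neighbours is; it becomes a `tail` if it has no open neighbour, an `inner` vertex of a path if
it has one, and a `joint` of two paths otherwise. One of the two paths at a joint is then traversed
downwards, and its vertices are marked as such. -/
inductive Mark
  | unseen | tail | inner | tailDown | innerPending | innerDown | joint
  deriving DecidableEq

instance : Fintype Mark :=
  Fintype.ofList [.unseen, .tail, .inner, .tailDown, .innerPending, .innerDown, .joint] (by
    intro m
    cases m <;> simp)

namespace Mark

/-- The vertex is the upper end of a path that is not traversed downwards so far. -/
def isOpen : Mark → Bool
  | tail | inner => true
  | _ => false

/-- The vertex is on a path that is traversed downwards. -/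
def isDown : Mark → Bool
  | tailDown | innerPending | innerDown => true
  | _ => false

/-- The number of open children, capped at two. -/
def children : Mark → ℕ
  | unseen => 3
  | tail | tailDown => 0
  | inner | innerPending | innerDown => 1
  | joint => 2

/-- The mark of an open vertex after its path has become one that is traversed downwards. -/
def turn : Mark → Mark
  | tail => tailDown
  | inner => innerPending
  | m => m

/-- A bound for the number of changes that a vertex with this mark can cause. -/
def weight : Mark → ℕ
  | unseen => 3
  | tail | inner => 2
  | tailDown | innerPending => 1
  | innerDown | joint => 0

end Mark

/-! ### The invariant of the elimination. -/

section Invariant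

variable {V : Type*}

/-- What is known of the marks `s` in the course of the elimination; `t` is the time at which a
vertex was eliminated, and `N` the present time. -/
structure EliminationInvariant (G : Digraph V) (s : V → Mark) (t : V → ℕ) (N : ℕ) : Prop where
  symm : ∀ u v, Nbr G u v → Nbr G v u
  time_unseen : ∀ v, s v = .unseen → t v = N
  time_seen : ∀ v, s v ≠ .unseen → t v < N
  time_ne : ∀ u v, Nbr G u v → s u ≠ .unseen → t u ≠ t v
  parent_unique : ∀ v a b, s v ≠ .unseen → Nbr G v a → Nbr G v b → t v < t a → t v < t b → a = b
  of_zero : ∀ v c, (s v).children = 0 → ¬ OpenChild G t (fun x => (s x).children) c v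
  of_one : ∀ v, (s v).children = 1 → ∃ c, OpenChild G t (fun x => (s x).children) c v ∧
    ((s c).isDown ↔ s v = .innerDown) ∧
    ∀ c', OpenChild G t (fun x => (s x).children) c' v → c' = c
  of_two : ∀ v, s v = .joint → ∃ c, OpenChild G t (fun x => (s x).children) c v ∧ (s c).isDown ∧
    (∀ c', OpenChild G t (fun x => (s x).children) c' v → (s c').isDown → c' = c) ∧
    ∃ c', OpenChild G t (fun x => (s x).children) c' v ∧ c' ≠ c
  down_parent : ∀ v, (s v).isDown → ∃ p, Nbr G v p ∧ t v < t p ∧ (s p = .joint ∨ s p = .innerDown)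

theorem eliminationInvariant_unseen {G : Digraph V} (hG : ∀ u v, Nbr G u v → Nbr G v u) :
    EliminationInvariant G (fun _ => .unseen) (fun _ => 0) 0 where
  symm := hG
  time_unseen := by simp
  time_seen := by simp
  time_ne := by simp
  parent_unique := by simp
  of_zero := by simp [Mark.children]
  of_one := by simp [Mark.children]
  of_two := by simp
  down_parent := by simp [Mark.isDown]

variable {G : Digraph V} {s s' : V → Mark} {t : V → ℕ} {N : ℕ}

/-- In the absence of pending vertices, `innerDown` is the only way for a vertex with one open child
to be down, so the two forms of `of_one` agree. -/
theorem EliminationInvariant.certificate (h : EliminationInvariant G s t N)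
    (hu : ∀ v, s v ≠ .unseen) (hp : ∀ v, s v ≠ .innerPending) :
    IsEliminationCertificate G t (fun v => (s v).children) (fun v => (s v).isDown) where
  symm := h.symm
  time_ne u v huv := h.time_ne u v huv (hu u)
  parent_unique v a b := h.parent_unique v a b (hu v)
  le_two v := by
    have := hu v
    cases hs : s v <;> simp_all [Mark.children]
  of_zero := h.of_zero
  of_one v hv := by
    obtain ⟨c, h1, h2, h3⟩ := h.of_one v hv
    refine ⟨c, h1, h2.trans ?_, h3⟩
    have := hp v
    cases hs : s v <;> simp_all [Mark.children, Mark.isDown]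
  of_two v hv := h.of_two v (by cases hs : s v <;> simp_all [Mark.children])
  down_le v hv := by cases hs : s v <;> simp_all [Mark.children, Mark.isDown]
  down_parent v hv := by
    obtain ⟨p, h1, h2, _⟩ := h.down_parent v hv
    exact ⟨p, h1, h2⟩

/-- One change of the marks. -/
inductive EliminationStep (G : Digraph V) (s s' : V → Mark) : Prop
  | seen (i : V) : s i = .unseen →
      (∀ a b, Nbr G i a → Nbr G i b → s a = .unseen → s b = .unseen → a = b) →
      (s' i = .tail ∧ (∀ c, Nbr G i c → (s c).isOpen = false) ∧ (∀ u, u ≠ i → s' u = s u) ∨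
       s' i = .inner ∧ (∃ c, Nbr G i c ∧ (s c).isOpen ∧ ∀ c', Nbr G i c' → (s c').isOpen → c' = c) ∧
        (∀ u, u ≠ i → s' u = s u) ∨
       s' i = .joint ∧ ∃ c, Nbr G i c ∧ (s c).isOpen ∧ s' c = (s c).turn ∧
        (∀ u, u ≠ i → u ≠ c → s' u = s u) ∧ ∃ c', Nbr G i c' ∧ (s c').isOpen ∧ c' ≠ c) →
      EliminationStep G s s'
  | down (i c : V) : s i = .innerPending → Nbr G i c → (s c).isOpen → s' i = .innerDown →
      s' c = (s c).turn → (∀ u, u ≠ i → u ≠ c → s' u = s u) → EliminationStep G s s'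

theorem Mark.turn_cases {m : Mark} (h : m.isOpen) :
    m = .tail ∧ m.turn = .tailDown ∨ m = .inner ∧ m.turn = .innerPending := by
  cases m <;> simp_all [isOpen, turn]

/-- The numbers of children stay the same; only the directions at `i` and `c` change, and `c` takes
over the pending status if it is inner. -/
theorem EliminationInvariant.down (h : EliminationInvariant G s t N) {i c : V}
    (hi : s i = .innerPending) (hic : Nbr G i c) (hc : (s c).isOpen) (hi' : s' i = .innerDown)
    (hc' : s' c = (s c).turn) (hs' : ∀ u, u ≠ i → u ≠ c → s' u = s u) :
    EliminationInvariant G s' t N := by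
  have hturn := Mark.turn_cases hc
  have hk : ∀ u, (s' u).children = (s u).children := by
    intro u
    by_cases hui : u = i
    · rw [hui, hi, hi']; rfl
    · by_cases huc : u = c
      · rw [huc, hc']
        rcases hturn with ⟨a, b⟩ | ⟨a, b⟩ <;> rw [b, a] <;> rfl
      · rw [hs' u hui huc]
  have hun : ∀ u, s' u = .unseen ↔ s u = .unseen := by
    intro u
    by_cases hui : u = i
    · simp [hui, hi, hi']
    · by_cases huc : u = c
      · rw [huc, hc']
        rcases hturn with ⟨a, b⟩ | ⟨a, b⟩ <;> simp [a, Mark.turn]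
      · rw [hs' u hui huc]
  have hop : (fun x => (s' x).children) = fun x => (s x).children := funext hk
  obtain ⟨p, hip, hlt, hp⟩ := h.down_parent i (by rw [hi]; rfl)
  -- The parent of `i` is a joint or `innerDown`, hence not open, so the open neighbour `c` is a
  -- child.
  have hci : t c < t i := by
    rcases lt_trichotomy (t c) (t i) with h1 | h1 | h1
    · exact h1
    · exact absurd h1.symm (h.time_ne i c hic (by simp [hi]))
    · have := h.parent_unique i c p (by simp [hi]) hic hip h1 hlt
      rcases hturn with ⟨a, _⟩ | ⟨a, _⟩ <;> rw [← this, a] at hp <;> simp at hp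
  have hcu : s c ≠ .unseen := by rcases hturn with ⟨a, _⟩ | ⟨a, _⟩ <;> simp [a]
  have hcD : (s c).isDown = false := by rcases hturn with ⟨a, _⟩ | ⟨a, _⟩ <;> rw [a] <;> rfl
  have hcD' : (s' c).isDown = true := by
    rw [hc']; rcases hturn with ⟨_, a⟩ | ⟨_, a⟩ <;> rw [a] <;> rfl
  have hcn : s' c ≠ .innerDown ∧ s c ≠ .innerDown := by
    rw [hc']; rcases hturn with ⟨a, b⟩ | ⟨a, b⟩ <;> simp [a, Mark.turn]
  have hcj : s' c ≠ .joint ∧ s c ≠ .joint := by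
    rw [hc']; rcases hturn with ⟨a, b⟩ | ⟨a, b⟩ <;> simp [a, Mark.turn]
  have hD : ∀ u, u ≠ c → (s' u).isDown = (s u).isDown := by
    intro u huc
    by_cases hui : u = i
    · rw [hui, hi, hi']; rfl
    · rw [hs' u hui huc]
  -- No vertex but `i` has `c` as an open child, so the conditions on children elsewhere do not see
  -- its new mark.
  have hpar : ∀ v, OpenChild G t (fun x => (s x).children) c v → v = i := fun v hv =>
    h.parent_unique c v i hcu hv.1 (h.symm _ _ hic) hv.2.1 hci
  refine ⟨h.symm, fun v hv => h.time_unseen v ((hun v).1 hv),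
    fun v hv => h.time_seen v (mt (hun v).2 hv), fun u v huv hu => h.time_ne u v huv (mt (hun u).2 hu),
    fun v a b hv => h.parent_unique v a b (mt (hun v).2 hv), ?_, ?_, ?_, ?_⟩
  · intro v d hv
    rw [hop]
    exact h.of_zero v d (hk v ▸ hv)
  · intro v hv
    rw [hk] at hv
    rw [hop]
    obtain ⟨d, h1, h2, h3⟩ := h.of_one v hv
    refine ⟨d, h1, ?_, h3⟩
    by_cases hvi : v = i
    · subst hvi
      have : c = d := h3 c ⟨h.symm _ _ hic, hci, by
        show (s c).children ≤ 1
        rcases hturn with ⟨a, _⟩ | ⟨a, _⟩ <;> rw [a] <;> simp [Mark.children]⟩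
      rw [← this]
      simp [hcD', hi']
    · have hdc : d ≠ c := by rintro rfl; exact hvi (hpar v h1)
      rw [hD d hdc, h2]
      by_cases hvc : v = c
      · simp [hvc, hcn.1, hcn.2]
      · rw [hs' v hvi hvc]
  · intro v hv
    have hvi : v ≠ i := by rintro rfl; simp [hi'] at hv
    have hvc : v ≠ c := by rintro rfl; exact hcj.1 hv
    rw [hs' v hvi hvc] at hv
    rw [hop]
    obtain ⟨d, h1, h2, h3, h4⟩ := h.of_two v hv
    have hne : ∀ d, OpenChild G t (fun x => (s x).children) d v → d ≠ c := by
      rintro d hd rfl; exact hvi (hpar v hd)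
    refine ⟨d, h1, by rw [hD d (hne d h1)]; exact h2, fun c' h5 h6 => ?_, h4⟩
    rw [hD c' (hne c' h5)] at h6
    exact h3 c' h5 h6
  · intro v hv
    by_cases hvc : v = c
    · rw [hvc]
      exact ⟨i, h.symm _ _ hic, hci, Or.inr hi'⟩
    · rw [hD v hvc] at hv
      obtain ⟨q, h1, h2, h3⟩ := h.down_parent v hv
      refine ⟨q, h1, h2, ?_⟩
      by_cases hqi : q = i
      · exact Or.inr (hqi ▸ hi')
      · have hqc : q ≠ c := by
          rintro rfl
          exact h3.elim hcj.2 hcn.2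
        rwa [hs' q hqi hqc]

-- Eliminating `i` leaves the open children of vertices seen before as they were. The open children
-- of `i` itself are exactly its open neighbours, whose number decides its mark.
open Classical in
theorem EliminationInvariant.seen (h : EliminationInvariant G s t N) {i : V}
    (hi : s i = .unseen)
    (huniq : ∀ a b, Nbr G i a → Nbr G i b → s a = .unseen → s b = .unseen → a = b)
    (hk : ∀ u, u ≠ i → (s' u).children = (s u).children)
    (hi' : s' i = .tail ∧ (∀ c, Nbr G i c → (s c).isOpen = false) ∧ (∀ u, u ≠ i → s' u = s u) ∨
       s' i = .inner ∧ (∃ c, Nbr G i c ∧ (s c).isOpen ∧ ∀ c', Nbr G i c' → (s c').isOpen → c' = c) ∧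
        (∀ u, u ≠ i → s' u = s u) ∨
       s' i = .joint ∧ ∃ c, Nbr G i c ∧ (s c).isOpen ∧ s' c = (s c).turn ∧
        (∀ u, u ≠ i → u ≠ c → s' u = s u) ∧ ∃ c', Nbr G i c' ∧ (s c').isOpen ∧ c' ≠ c) :
    EliminationInvariant G s' (fun u => if s u = .unseen ∧ u ≠ i then N + 1 else t u) (N + 1) := by
  -- Vertex `i` keeps the time `N` and the other unseen vertices move on to `N + 1`, so they are
  -- what comes after `i`.
  set t' : V → ℕ := fun u => if s u = .unseen ∧ u ≠ i then N + 1 else t u with ht'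
  have hiu : s' i ≠ .unseen := by rcases hi' with ⟨a, _⟩ | ⟨a, _⟩ | ⟨a, _⟩ <;> simp [a]
  have hch : ∀ m : Mark, m.children = 3 ↔ m = .unseen := by
    intro m; cases m <;> simp [Mark.children]
  have hun : ∀ u, u ≠ i → (s' u = .unseen ↔ s u = .unseen) := by
    intro u hu
    rw [← hch, ← hch, hk u hu]
  have t1 : ∀ u, s u ≠ .unseen → t' u = t u := fun u hu => by simp [ht', hu]
  have t2 : t' i = N := by simp [ht', h.time_unseen i hi]
  have t3 : ∀ u, u ≠ i → s u = .unseen → t' u = N + 1 := fun u hu hs => by simp [ht', hu, hs]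
  have tge : ∀ u, s u = .unseen → N ≤ t' u := by
    intro u hu
    by_cases hui : u = i
    · rw [hui, t2]
    · rw [t3 u hui hu]; omega
  have tlt : ∀ u v, s u ≠ .unseen → (t' u < t' v ↔ t u < t v) := by
    intro u v hu
    rw [t1 u hu]
    by_cases hv : s v = .unseen
    · have := tge v hv
      have := h.time_seen u hu
      rw [h.time_unseen v hv]
      constructor <;> intro <;> omega
    · rw [t1 v hv]
  have tno : ∀ u v, s u = .unseen → s v ≠ .unseen → ¬ t' u < t' v := by
    intro u v hu hv
    have := tge u hu
    have := h.time_seen v hv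
    rw [t1 v hv]
    omega
  have kle : ∀ m : Mark, m.children ≤ 1 → m ≠ .unseen := by
    intro m; cases m <;> simp [Mark.children]
  have hop : ∀ c v, v ≠ i → s v ≠ .unseen → (OpenChild G t' (fun x => (s' x).children) c v ↔
      OpenChild G t (fun x => (s x).children) c v) := by
    intro c v hvi hv
    constructor
    · rintro ⟨a, b, d⟩
      have hc : s c ≠ .unseen := fun hc => tno c v hc hv b
      have hci : c ≠ i := by rintro rfl; exact hc hi
      exact ⟨a, (tlt c v hc).1 b, (hk c hci).symm.le.trans d⟩
    · rintro ⟨a, b, d⟩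
      have hc := kle _ d
      have hci : c ≠ i := by rintro rfl; exact hc hi
      refine ⟨a, (tlt c v hc).2 b, ?_⟩
      show (s' c).children ≤ 1
      rw [hk c hci]
      exact d
  have open_iff : ∀ m : Mark, m.isOpen ↔ m.children ≤ 1 ∧ m.isDown = false := by
    intro m; cases m <;> simp [Mark.children, Mark.isOpen, Mark.isDown]
  -- The parent of a down vertex is its only later neighbour and has been seen, whereas `i` is
  -- unseen and later than every seen vertex.
  have hdown : ∀ c, Nbr G i c → (s c).isDown = false := by
    intro c hic
    by_contra hD
    rw [Bool.not_eq_false] at hD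
    obtain ⟨p, h1, h2, h3⟩ := h.down_parent c hD
    have hcu : s c ≠ .unseen := by intro h4; rw [h4] at hD; simp [Mark.isDown] at hD
    have := h.parent_unique c p i hcu h1 (h.symm _ _ hic) h2 (by
      rw [h.time_unseen i hi]; exact h.time_seen c hcu)
    rw [this, hi] at h3
    simp at h3
  have hopi : ∀ c, OpenChild G t' (fun x => (s' x).children) c i ↔ Nbr G i c ∧ (s c).isOpen := by
    intro c
    constructor
    · rintro ⟨a, b, d⟩
      have hci : c ≠ i := a.2
      change (s' c).children ≤ 1 at d
      rw [hk c hci] at d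
      have hic := h.symm _ _ a
      exact ⟨hic, (open_iff _).2 ⟨d, hdown c hic⟩⟩
    · rintro ⟨hic, ho⟩
      have hci : c ≠ i := hic.2.symm
      have hc := ((open_iff _).1 ho).1
      have hcu := kle _ hc
      refine ⟨h.symm _ _ hic, ?_, ?_⟩
      · rw [t2, t1 c hcu]
        exact h.time_seen c hcu
      · change (s' c).children ≤ 1
        rwa [hk c hci]
  have hD : ∀ u v, OpenChild G t (fun x => (s x).children) u v → s v ≠ .unseen →
      (s' u).isDown = (s u).isDown := by
    intro u v huv hv
    have hui : u ≠ i := by rintro rfl; exact kle _ huv.2.2 hi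
    rcases hi' with ⟨_, _, a⟩ | ⟨_, _, a⟩ | ⟨_, c, hic, _, _, a, _⟩
    · rw [a u hui]
    · rw [a u hui]
    · by_cases huc : u = c
      · subst huc
        have hu := kle _ huv.2.2
        have := h.parent_unique u v i hu huv.1 (h.symm _ _ hic) huv.2.1 (by
          rw [h.time_unseen i hi]; exact h.time_seen u hu)
        exact absurd hi (this ▸ hv)
      · rw [a u hui huc]
  have hdone : ∀ u, s u = .joint ∨ s u = .innerDown ∨ s u = .tailDown ∨ s u = .innerPending →
      s' u = s u := by
    intro u hu
    have hui : u ≠ i := by rintro rfl; simp [hi] at hu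
    rcases hi' with ⟨_, _, a⟩ | ⟨_, _, a⟩ | ⟨_, c, hic, hco, _, a, _⟩
    · exact a u hui
    · exact a u hui
    · refine a u hui ?_
      rintro rfl
      rcases hu with b | b | b | b <;> simp [b, Mark.isOpen] at hco
  have hback : ∀ u, u ≠ i → s' u = .joint ∨ s' u = .innerDown → s' u = s u := by
    intro u hui hu
    rcases hi' with ⟨_, _, a⟩ | ⟨_, _, a⟩ | ⟨_, c, hic, hco, hc', a, _⟩
    · exact a u hui
    · exact a u hui
    · refine a u hui ?_
      rintro rfl
      rcases Mark.turn_cases hco with ⟨_, b⟩ | ⟨_, b⟩ <;> simp [hc', b] at hu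
  refine ⟨h.symm, ?_, ?_, ?_, ?_, ?_, ?_, ?_, ?_⟩
  · intro v hv
    have hvi : v ≠ i := by rintro rfl; exact hiu hv
    exact t3 v hvi ((hun v hvi).1 hv)
  · intro v hv
    by_cases hvi : v = i
    · rw [hvi, t2]; omega
    · have := mt (hun v hvi).2 hv
      rw [t1 v this]
      have := h.time_seen v this
      omega
  · intro u v huv hu
    by_cases hui : u = i
    · subst hui
      rw [t2]
      by_cases hv : s v = .unseen
      · rw [t3 v huv.2.symm hv]; omega
      · rw [t1 v hv]
        have := h.time_seen v hv
        omega
    · have hsu := mt (hun u hui).2 hu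
      by_cases hv : s v = .unseen
      · have := tge v hv
        have := h.time_seen u hsu
        rw [t1 u hsu]
        omega
      · rw [t1 u hsu, t1 v hv]
        exact h.time_ne u v huv hsu
  · intro v a b hv hva hvb hlta hltb
    by_cases hvi : v = i
    · subst hvi
      rw [t2] at hlta hltb
      have : ∀ a, N < t' a → s a = .unseen := by
        intro a ha
        by_contra hau
        rw [t1 a hau] at ha
        have := h.time_seen a hau
        omega
      exact huniq a b hva hvb (this a hlta) (this b hltb)
    · have hsv := mt (hun v hvi).2 hv
      exact h.parent_unique v a b hsv hva hvb ((tlt v a hsv).1 hlta) ((tlt v b hsv).1 hltb)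
  · intro v c hv
    by_cases hvi : v = i
    · subst hvi
      rw [hopi]
      rintro ⟨h1, h2⟩
      rcases hi' with ⟨_, a, _⟩ | ⟨a, _⟩ | ⟨a, _⟩
      · simp [a c h1] at h2
      · simp [a, Mark.children] at hv
      · simp [a, Mark.children] at hv
    · rw [hk v hvi] at hv
      rw [hop c v hvi (kle _ (by omega))]
      exact h.of_zero v c hv
  · intro v hv
    by_cases hvi : v = i
    · subst hvi
      rcases hi' with ⟨a, _⟩ | ⟨a, ⟨c, h1, h2, h3⟩, a'⟩ | ⟨a, _⟩
      · simp [a, Mark.children] at hv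
      · refine ⟨c, (hopi c).2 ⟨h1, h2⟩, ?_, fun c' hc' => ?_⟩
        · rw [a' c h1.2.symm, hdown c h1, a]
          simp
        · obtain ⟨h4, h5⟩ := (hopi c').1 hc'
          exact h3 c' h4 h5
      · simp [a, Mark.children] at hv
    · rw [hk v hvi] at hv
      have hvu := kle _ (le_of_eq hv)
      obtain ⟨c, h1, h2, h3⟩ := h.of_one v hv
      refine ⟨c, (hop c v hvi hvu).2 h1, ?_, fun c' hc' => h3 c' ((hop c' v hvi hvu).1 hc')⟩
      rw [hD c v h1 hvu, h2]
      constructor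
      · intro h4
        rw [hdone v (by simp [h4]), h4]
      · intro h4
        rw [← hback v hvi (Or.inr h4), h4]
  · intro v hv
    by_cases hvi : v = i
    · subst hvi
      rcases hi' with ⟨a, _⟩ | ⟨a, _⟩ | ⟨a, c, h1, h2, h3, h4, c', h5, h6, h7⟩
      · simp [a] at hv
      · simp [a] at hv
      · refine ⟨c, (hopi c).2 ⟨h1, h2⟩, ?_, ?_, c', (hopi c').2 ⟨h5, h6⟩, h7⟩
        · rw [h3]
          rcases Mark.turn_cases h2 with ⟨_, b⟩ | ⟨_, b⟩ <;> rw [b] <;> rfl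
        · intro d hd hdD
          obtain ⟨h8, h9⟩ := (hopi d).1 hd
          by_contra hdc
          rw [h4 d h8.2.symm hdc, hdown d h8] at hdD
          simp at hdD
    · rw [hback v hvi (Or.inl hv)] at hv
      have hvu : s v ≠ .unseen := by simp [hv]
      obtain ⟨c, h1, h2, h3, c', h4, h5⟩ := h.of_two v hv
      refine ⟨c, (hop c v hvi hvu).2 h1, by rw [hD c v h1 hvu]; exact h2, fun d hd hdD => ?_,
        c', (hop c' v hvi hvu).2 h4, h5⟩
      have hd' := (hop d v hvi hvu).1 hd
      rw [hD d v hd' hvu] at hdD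
      exact h3 d hd' hdD
  · intro v hv
    by_cases hvi : v = i
    · subst hvi
      rcases hi' with ⟨a, _⟩ | ⟨a, _⟩ | ⟨a, _⟩ <;> simp [a, Mark.isDown] at hv
    · have old : (s v).isDown → ∃ p, Nbr G v p ∧ t' v < t' p ∧ (s' p = .joint ∨ s' p = .innerDown) := by
        intro hvD
        obtain ⟨p, h1, h2, h3⟩ := h.down_parent v hvD
        have hvu : s v ≠ .unseen := by intro h4; rw [h4] at hvD; simp [Mark.isDown] at hvD
        refine ⟨p, h1, (tlt v p hvu).2 h2, ?_⟩
        rw [hdone p (h3.elim Or.inl fun h4 => Or.inr (Or.inl h4))]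
        exact h3
      rcases hi' with ⟨_, _, a⟩ | ⟨_, _, a⟩ | ⟨hj, c, hic, hco, hc', a, _⟩
      · exact old (a v hvi ▸ hv)
      · exact old (a v hvi ▸ hv)
      · by_cases hvc : v = c
        · subst hvc
          exact ⟨i, h.symm _ _ hic, ((hopi v).2 ⟨hic, hco⟩).2.1, Or.inl hj⟩
        · exact old (a v hvi hvc ▸ hv)

theorem EliminationInvariant.step (h : EliminationInvariant G s t N)
    (hs : EliminationStep G s s') : ∃ t' N', EliminationInvariant G s' t' N' := by
  cases hs with
  | down i c h1 h2 h3 h4 h5 h6 => exact ⟨_, _, h.down h1 h2 h3 h4 h5 h6⟩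
  | seen i h1 h2 h3 =>
    refine ⟨_, _, h.seen h1 h2 ?_ h3⟩
    intro u hu
    rcases h3 with ⟨_, _, a⟩ | ⟨_, _, a⟩ | ⟨_, c, _, hco, hc', a, _⟩
    · rw [a u hu]
    · rw [a u hu]
    · by_cases huc : u = c
      · rw [huc, hc']
        rcases Mark.turn_cases hco with ⟨b, b'⟩ | ⟨b, b'⟩ <;> rw [b', b] <;> rfl
      · rw [a u hu huc]

/-- The single open child is not down, because its parent is not yet `innerDown`; so its mark is
open. -/
theorem EliminationInvariant.exists_open_of_pending (h : EliminationInvariant G s t N) {i : V}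
    (hi : s i = .innerPending) : ∃ c, Nbr G i c ∧ (s c).isOpen := by
  obtain ⟨c, h1, h2, _⟩ := h.of_one i (by rw [hi]; rfl)
  refine ⟨c, h.symm _ _ h1.1, ?_⟩
  have hk : (s c).children ≤ 1 := h1.2.2
  cases hc : s c <;> simp_all [Mark.children, Mark.isOpen, Mark.isDown]

end Invariant

/-- A counter that does not distinguish the numbers from two on. -/
inductive Count
  | zero | one | many
  deriving DecidableEq

instance : Fintype Count :=
  Fintype.ofList [.zero, .one, .many] (by
    intro m
    cases m <;> simp)

namespace Count

/-- One more. -/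
def succ : Count → Count
  | zero => one
  | _ => many

/-- The value of the counter at a number. -/
def cap : ℕ → Count
  | 0 => zero
  | 1 => one
  | _ => many

theorem succ_cap (k : ℕ) : (cap k).succ = cap (k + 1) := by
  match k with
  | 0 => rfl
  | 1 => rfl
  | _ + 2 => rfl

theorem cap_eq_zero {k : ℕ} : cap k = zero ↔ k = 0 := by
  match k with
  | 0 => simp [cap]
  | 1 => simp [cap]
  | _ + 2 => simp [cap]

theorem cap_eq_one {k : ℕ} : cap k = one ↔ k = 1 := by
  match k with
  | 0 => simp [cap]
  | 1 => simp [cap]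
  | _ + 2 => simp [cap]

theorem cap_eq_many {k : ℕ} : cap k = many ↔ 2 ≤ k := by
  match k with
  | 0 => simp [cap]
  | 1 => simp [cap]
  | _ + 2 => simp [cap]

end Count

namespace Mark

/-- Whether the elimination changes the mark of a vertex that has `w` unseen and `o` open
neighbours. -/
def changes (m : Mark) (w : Count) : Bool :=
  match m, w with
  | unseen, .zero | unseen, .one | innerPending, _ => true
  | _, _ => false

/-- The new mark of a vertex that has `w` unseen and `o` open neighbours. -/
def next (m : Mark) (w o : Count) : Mark :=
  match m, w, o with
  | unseen, .many, _ => unseen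
  | unseen, _, .zero => tail
  | unseen, _, .one => inner
  | unseen, _, .many => joint
  | innerPending, _, _ => innerDown
  | m, _, _ => m

/-- Whether the path through the first open neighbour is to be turned downwards. -/
def turns (m : Mark) (w o : Count) : Bool :=
  match m, w, o with
  | unseen, .many, _ => false
  | unseen, _, .many => true
  | innerPending, _, _ => true
  | _, _, _ => false

theorem next_eq_self {m : Mark} {w : Count} (o : Count) (h : m.changes w = false) :
    m.next w o = m := by
  cases m <;> cases w <;> simp_all [changes, next]

theorem turns_eq_false {m : Mark} {w : Count} (o : Count) (h : m.changes w = false) :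
    m.turns w o = false := by
  cases m <;> cases w <;> simp_all [changes, turns]

theorem weight_next_lt {m : Mark} {w : Count} (o : Count) (h : m.changes w) :
    (m.next w o).weight < m.weight := by
  cases m <;> cases w <;> cases o <;> simp_all [changes, next, weight]

theorem weight_turn_le (m : Mark) : m.turn.weight ≤ m.weight := by
  cases m <;> simp [turn, weight]

end Mark

/-! ### One row of the matrix as an elimination step, and the decreasing weight. -/

section Sweep

variable (adj : ℕ → ℕ → Bool) (s : ℕ → Mark) (n i : ℕ)

/-- Vertex `j` is an unseen neighbour of `i`. -/
def unseenNbr (j : ℕ) : Bool := adj i j && !decide (j = i) && decide (s j = .unseen)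

/-- Vertex `j` is an open neighbour of `i`. -/
def openNbr (j : ℕ) : Bool := adj i j && !decide (j = i) && (s j).isOpen

/-- Vertex `j` is the first open neighbour of `i`. -/
def firstOpenNbr (j : ℕ) : Bool :=
  openNbr adj s i j && decide (Count.cap (Nat.count (fun j => openNbr adj s i j) j) = .zero)

/-- The number of unseen neighbours of `i` below `n`. -/
def unseenCount : Count := .cap (Nat.count (fun j => unseenNbr adj s i j) n)

/-- The number of open neighbours of `i` below `n`. -/
def openCount : Count := .cap (Nat.count (fun j => openNbr adj s i j) n)

/-- The marks after vertex `i` has been dealt with. -/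
def sweepRow (j : ℕ) : Mark :=
  if j = i then (s i).next (unseenCount adj s n i) (openCount adj s n i)
  else if (s i).turns (unseenCount adj s n i) (openCount adj s n i) && firstOpenNbr adj s i j then
    (s j).turn
  else s j

/-- A bound for the number of changes still to come. -/
def totalWeight : ℕ := ∑ j ∈ Finset.range n, (s j).weight

variable {adj s n i}

theorem sweepRow_eq_self (h : (s i).changes (unseenCount adj s n i) = false) :
    sweepRow adj s n i = s := by
  ext j
  rw [sweepRow, Mark.turns_eq_false _ h, Mark.next_eq_self _ h]
  split_ifs with h1 h2
  · rw [h1]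
  · simp at h2
  · rfl

/-- The vertex dealt with loses weight, and turning a path never adds any; so the weight bounds the
number of changes. -/
theorem totalWeight_sweepRow_lt (hi : i < n) (h : (s i).changes (unseenCount adj s n i)) :
    totalWeight (sweepRow adj s n i) n < totalWeight s n := by
  refine Finset.sum_lt_sum (fun j _ => ?_) ⟨i, Finset.mem_range.2 hi, ?_⟩
  · rw [sweepRow]
    split_ifs with h1 h2
    · rw [h1]
      exact (Mark.weight_next_lt _ h).le
    · exact Mark.weight_turn_le _
    · exact le_rfl
  · rw [sweepRow, if_pos rfl]
    exact Mark.weight_next_lt _ h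

theorem totalWeight_unseen (n : ℕ) : totalWeight (fun _ => .unseen) n = 3 * n := by
  simp [totalWeight, Mark.weight, mul_comm]

theorem count_eq_zero_iff (p : ℕ → Bool) (n : ℕ) :
    Nat.count (fun j => p j) n = 0 ↔ ∀ j : Fin n, p j = false := by
  rw [Nat.count_eq_card_filter_range, Finset.card_eq_zero, Finset.filter_eq_empty_iff]
  exact ⟨fun h j => by simpa using h (Finset.mem_range.2 j.2),
    fun h j hj => by simpa using h ⟨j, Finset.mem_range.1 hj⟩⟩

theorem count_le_one_iff (p : ℕ → Bool) (n : ℕ) :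
    Nat.count (fun j => p j) n ≤ 1 ↔ ∀ a b : Fin n, p a → p b → a = b := by
  rw [Nat.count_eq_card_filter_range, Finset.card_le_one]
  simp only [Finset.mem_filter, Finset.mem_range]
  exact ⟨fun h a b ha hb => Fin.ext (h a ⟨a.2, ha⟩ b ⟨b.2, hb⟩),
    fun h a ha b hb => congrArg Fin.val (h ⟨a, ha.1⟩ ⟨b, hb.1⟩ ha.2 hb.2)⟩

theorem exists_firstOpenNbr (h : ∃ j : Fin n, openNbr adj s i j) :
    ∃ c : Fin n, openNbr adj s i c ∧ ∀ j, firstOpenNbr adj s i j ↔ j = c := by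
  have h' : ∃ j, openNbr adj s i j := ⟨_, h.choose_spec⟩
  have hlt : Nat.find h' < n := (Nat.find_min' h' h.choose_spec).trans_lt h.choose.2
  refine ⟨⟨Nat.find h', hlt⟩, Nat.find_spec h', fun j => ?_⟩
  rw [firstOpenNbr, Bool.and_eq_true, decide_eq_true_iff, Count.cap_eq_zero,
    count_eq_zero_iff]
  constructor
  · rintro ⟨h1, h2⟩
    refine le_antisymm ?_ (Nat.find_min' h' h1)
    by_contra hlt
    have := h2 ⟨_, not_le.1 hlt⟩
    rw [Nat.find_spec h'] at this
    simp at this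
  · rintro rfl
    refine ⟨Nat.find_spec h', fun k => ?_⟩
    simpa using Nat.find_min h' k.2

variable {G : Digraph (Fin n)} {t : Fin n → ℕ} {N : ℕ}

theorem unseenNbr_iff (hadj : ∀ u v : Fin n, adj u v ↔ G.Adj u v) (i j : Fin n) :
    unseenNbr adj s i j ↔ Nbr G i j ∧ s j = .unseen := by
  simp only [unseenNbr, Bool.and_eq_true, hadj, Nbr, Bool.not_eq_true', decide_eq_false_iff_not,
    decide_eq_true_iff, Fin.val_inj, ne_eq, eq_comm (a := i)]

theorem openNbr_iff (hadj : ∀ u v : Fin n, adj u v ↔ G.Adj u v) (i j : Fin n) :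
    openNbr adj s i j ↔ Nbr G i j ∧ (s j).isOpen := by
  simp only [openNbr, Bool.and_eq_true, hadj, Nbr, Bool.not_eq_true', decide_eq_false_iff_not,
    Fin.val_inj, ne_eq, eq_comm (a := i)]

/-- The rules only distinguish none, one and several neighbours, which the capped counters retain.
-/
theorem EliminationInvariant.eliminationStep_sweepRow
    (hadj : ∀ u v : Fin n, adj u v ↔ G.Adj u v)
    (h : EliminationInvariant G (fun v : Fin n => s v) t N) (i : Fin n)
    (hc : (s i).changes (unseenCount adj s n i)) :
    EliminationStep G (fun v : Fin n => s v) (fun v : Fin n => sweepRow adj s n i v) := by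
  have hself : sweepRow adj s n i i = (s i).next (unseenCount adj s n i) (openCount adj s n i) :=
    if_pos rfl
  have hturn : ∀ c : Fin n, openNbr adj s i c → (∀ j, firstOpenNbr adj s i j ↔ j = c) →
      (s i).turns (unseenCount adj s n i) (openCount adj s n i) = true →
      sweepRow adj s n i c = (s c).turn ∧
      ∀ u : Fin n, u ≠ i → u ≠ c → sweepRow adj s n i u = s u := by
    intro c hoc hfc ht
    have hci : (c : ℕ) ≠ i := by
      have := ((openNbr_iff hadj i c).1 hoc).1.2
      exact fun e => this (Fin.ext e.symm)
    constructor
    · rw [sweepRow, if_neg hci, ht, (hfc c).2 rfl]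
      rfl
    · intro u hui huc
      rw [sweepRow, if_neg (fun e => hui (Fin.ext e)), if_neg]
      rw [Bool.and_eq_true, hfc]
      exact fun e => huc (Fin.ext e.2)
  by_cases hp : s i = .innerPending
  · obtain ⟨c₀, h1, h2⟩ := h.exists_open_of_pending (i := i) hp
    obtain ⟨c, hc1, hc2⟩ := exists_firstOpenNbr ⟨c₀, (openNbr_iff hadj i c₀).2 ⟨h1, h2⟩⟩
    obtain ⟨h3, h4⟩ := hturn c hc1 hc2 (by rw [hp]; rfl)
    obtain ⟨h5, h6⟩ := (openNbr_iff hadj i c).1 hc1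
    exact .down i c hp h5 h6 (by rw [hself, hp]; rfl) h3 h4
  · have hu : s i = .unseen := by
      cases hs : s i <;> simp_all [Mark.changes]
    have hw : unseenCount adj s n i ≠ .many := by
      intro hw
      simp [hu, hw, Mark.changes] at hc
    have hw' : Nat.count (fun j => unseenNbr adj s i j) n ≤ 1 := by
      have := mt Count.cap_eq_many.2 hw
      omega
    rw [count_le_one_iff] at hw'
    refine .seen i hu (fun a b ha hb hsa hsb => hw' a b ((unseenNbr_iff hadj i a).2 ⟨ha, hsa⟩)
      ((unseenNbr_iff hadj i b).2 ⟨hb, hsb⟩)) ?_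
    have hnoturn : (s i).turns (unseenCount adj s n i) (openCount adj s n i) = false →
        ∀ u : Fin n, u ≠ i → sweepRow adj s n i u = s u := by
      intro ht u hui
      rw [sweepRow, if_neg (fun e => hui (Fin.ext e)), ht]
      rfl
    cases ho : openCount adj s n i with
    | zero =>
      refine Or.inl ⟨?_, ?_, hnoturn ?_⟩
      · rw [hself, hu, ho]
        cases hx : unseenCount adj s n i <;> simp_all [Mark.next]
      · intro c hic
        rw [openCount, Count.cap_eq_zero, count_eq_zero_iff] at ho
        by_contra hco
        have := (openNbr_iff hadj i c).2 ⟨hic, by simpa using hco⟩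
        simp [ho c] at this
      · rw [hu, ho]
        cases hx : unseenCount adj s n i <;> rfl
    | one =>
      refine Or.inr (Or.inl ⟨?_, ?_, hnoturn ?_⟩)
      · rw [hself, hu, ho]
        cases hx : unseenCount adj s n i <;> simp_all [Mark.next]
      · rw [openCount, Count.cap_eq_one] at ho
        have h1 := (count_le_one_iff (fun j => openNbr adj s i j) n).1 ho.le
        have h0 : ¬ ∀ j : Fin n, openNbr adj s i j = false := by
          rw [← count_eq_zero_iff (fun j => openNbr adj s i j), ho]
          simp
        obtain ⟨c, hc⟩ := not_forall.1 h0
        rw [Bool.not_eq_false] at hc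
        obtain ⟨h2, h3⟩ := (openNbr_iff hadj i c).1 hc
        exact ⟨c, h2, h3, fun c' h4 h5 => h1 c' c ((openNbr_iff hadj i c').2 ⟨h4, h5⟩) hc⟩
      · rw [hu, ho]
        cases hx : unseenCount adj s n i <;> rfl
    | many =>
      have ht : (s i).turns (unseenCount adj s n i) (openCount adj s n i) = true := by
        rw [hu, ho]
        cases hx : unseenCount adj s n i <;> simp_all [Mark.turns]
      refine Or.inr (Or.inr ⟨?_, ?_⟩)
      · rw [hself, hu, ho]
        cases hx : unseenCount adj s n i <;> simp_all [Mark.next]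
      · rw [openCount, Count.cap_eq_many] at ho
        have h1 : ¬ ∀ a b : Fin n, openNbr adj s i a → openNbr adj s i b → a = b := by
          rw [← count_le_one_iff (fun j => openNbr adj s i j)]
          omega
        push Not at h1
        obtain ⟨a, b, ha, hb, hab⟩ := h1
        obtain ⟨c, hc1, hc2⟩ := exists_firstOpenNbr ⟨a, ha⟩
        obtain ⟨h3, h4⟩ := hturn c hc1 hc2 ht
        obtain ⟨h5, h6⟩ := (openNbr_iff hadj i c).1 hc1
        refine ⟨c, h5, h6, h3, h4, ?_⟩
        by_cases hac : a = c
        · obtain ⟨h7, h8⟩ := (openNbr_iff hadj i b).1 hb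
          exact ⟨b, h7, h8, fun e => hab (hac.trans e.symm)⟩
        · obtain ⟨h7, h8⟩ := (openNbr_iff hadj i a).1 ha
          exact ⟨a, h7, h8, hac⟩

/-- Marks that no row changes contain no pending and, in a forest, no unseen vertices; so they form
a certificate, whose set `S` consists of the tails. -/
theorem EliminationInvariant.isMinimumInputSet (hd : IsSelfDamped G) (hG : HasTreeStructure G)
    (hadj : ∀ u v : Fin n, adj u v ↔ G.Adj u v)
    (h : EliminationInvariant G (fun v : Fin n => s v) t N)
    (hc : ∀ i < n, (s i).changes (unseenCount adj s n i) = false) :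
    IsMinimumInputSet G (Finset.univ.filter fun v : Fin n => s v = .tail) := by
  obtain ⟨T, hT, hTG⟩ := hG
  have hp : ∀ v : Fin n, s v ≠ .innerPending := by
    intro v hv
    have := hc v v.2
    simp [hv, Mark.changes] at this
  have hu : ∀ v : Fin n, s v ≠ .unseen := by
    by_contra hex
    push Not at hex
    -- Some unseen vertex has at most one unseen neighbour, so its row would cause a change.
    obtain ⟨v, hv, huniq⟩ := exists_mem_forall_adj_eq_of_isAcyclic hT.isAcyclic
      {v : Fin n | s v = .unseen} hex
    have h1 : Nat.count (fun j => unseenNbr adj s v j) n ≤ 1 := by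
      rw [count_le_one_iff]
      intro a b ha hb
      obtain ⟨⟨ha1, ha2⟩, ha3⟩ := (unseenNbr_iff hadj v a).1 ha
      obtain ⟨⟨hb1, hb2⟩, hb3⟩ := (unseenNbr_iff hadj v b).1 hb
      exact huniq a ha3 b hb3 ((hTG _ _ ha2).1 ha1) ((hTG _ _ hb2).1 hb1)
    have h2 : unseenCount adj s n v ≠ .many := by
      rw [unseenCount, ne_eq, Count.cap_eq_many]
      omega
    have h3 := hc v v.2
    rw [show s v = .unseen from hv] at h3
    cases hx : unseenCount adj s n v <;> simp_all [Mark.changes]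
  have hcert := h.certificate hu hp
  have hS : ∀ v : Fin n, v ∈ (Finset.univ.filter fun v : Fin n => s v = .tail) ↔
      (s v).children = 0 ∧ ¬ (s v).isDown := by
    intro v
    rw [Finset.mem_filter]
    cases hv : s v <;> simp [Mark.children, Mark.isDown]
  exact ⟨stronglyControllable_of_isForcingSet (hcert.isForcingSet hS),
    fun S hS' => hcert.card_le hS (isForcingSet_of_stronglyControllable hd hS')⟩

end Sweep

/-! ### The stack machine. -/

open Turing Computability

/-- An entry of the vector of the marks: the mark of the vertex, whether the current row is its
own, whether the next one is, and whether it is the first open neighbour of the current vertex. -/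
structure Cell where
  mark : Mark
  here : Bool
  succ : Bool
  first : Bool

instance : Finite Cell :=
  Finite.of_injective (fun c : Cell => (c.mark, c.here, c.succ, c.first)) (by
    rintro ⟨⟩ ⟨⟩ h
    simp_all)

/-- The stacks: the rows of the matrix ahead and the ones behind (reversed), the entries ahead and
the ones behind (reversed), and the output. -/
inductive Stack
  | rows | rowsDone | cells | cellsDone | out
  deriving DecidableEq

instance : Fintype Stack :=
  Fintype.ofList [.rows, .rowsDone, .cells, .cellsDone, .out] (by
    intro m
    cases m <;> simp)

/-- The stack alphabets. -/
abbrev Stack.Symbol : Stack → Type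
  | rows | rowsDone => Γ'
  | cells | cellsDone => Cell
  | out => Bool

/-- The labels of the program. -/
inductive Label
  | start | rewind | scan | back | clear | reverse | output
  deriving DecidableEq

instance : Fintype Label :=
  Fintype.ofList [.start, .rewind, .scan, .back, .clear, .reverse, .output] (by
    intro m
    cases m <;> simp)

/-- The finite memory: the symbols read last, the mark of the current vertex, its numbers of
unseen and open neighbours so far, whether the entry read last was the one of the current vertex,
and whether there has been a change in the current pass. -/
structure Memory where
  symbol : Option Γ'
  cell : Option Cell
  mark : Mark
  unseen : Count
  opens : Count
  carry : Bool
  changed : Bool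

noncomputable instance : Fintype Memory :=
  haveI : Finite Memory :=
    Finite.of_injective (fun v : Memory =>
      (v.symbol, v.cell, v.mark, v.unseen, v.opens, v.carry, v.changed)) (by
      rintro ⟨⟩ ⟨⟩ h
      simp_all)
  Fintype.ofFinite _

namespace Memory

/-- The memory at the start. -/
def initial : Memory := ⟨none, none, .unseen, .zero, .zero, false, false⟩

/-- The symbols read last are dropped. -/
def forget (v : Memory) : Memory := { v with symbol := none, cell := none }

/-- The entry of a neighbour or the current vertex is read, with the adjacency bit `b`. -/
def read (v : Memory) (b : Bool) (c : Cell) : Memory where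
  symbol := v.symbol
  cell := some ⟨c.mark, c.here, v.carry,
    (b && !c.here && c.mark.isOpen) && decide (v.opens = .zero)⟩
  mark := if c.here then c.mark else v.mark
  unseen := if b && !c.here && decide (c.mark = .unseen) then v.unseen.succ else v.unseen
  opens := if b && !c.here && c.mark.isOpen then v.opens.succ else v.opens
  carry := c.here
  changed := v.changed

/-- The bit read last. -/
def bit (v : Memory) : Bool := decide (v.symbol = some (.bit true))

/-- The entry read last. -/
def theCell (v : Memory) : Cell := v.cell.getD ⟨.unseen, false, false, false⟩

/-- The symbol of the matrix read last. -/
def theSymbol (v : Memory) : Γ' := v.symbol.getD .blank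

/-- The entry is updated after the scan of a row. -/
def write (v : Memory) : Cell where
  mark := if v.theCell.here then v.mark.next v.unseen v.opens
    else if v.mark.turns v.unseen v.opens && v.theCell.first then v.theCell.mark.turn
    else v.theCell.mark
  here := v.theCell.succ
  succ := false
  first := false

/-- A row is finished. -/
def finish (v : Memory) : Memory :=
  { initial with changed := v.changed || v.mark.changes v.unseen }

end Memory

open TM2.Stmt in
/-- The program: the rows are scanned together with the marks, each scan is followed by an update
of the marks, and the passes through the matrix are repeated until there is no change. -/
def program : Label → TM2.Stmt Stack.Symbol Label Memory
  | .start =>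
    pop .rows (fun v a => { v with symbol := a }) <|
    push .rowsDone Memory.theSymbol <|
    branch (fun v => decide (v.symbol = some .comma))
      (load (fun _ => Memory.initial) <| goto fun _ => .rewind)
      (push .cells (fun _ => ⟨.unseen, false, false, false⟩) <|
        load (fun _ => Memory.initial) <| goto fun _ => .start)
  | .rewind =>
    pop .rowsDone (fun v a => { v with symbol := a }) <|
    branch (fun v => v.symbol.isSome)
      (push .rows Memory.theSymbol <| load Memory.forget <| goto fun _ => .rewind)
      (pop .cells (fun v c => { v with cell := c }) <|
        push .cells (fun v => { v.theCell with here := true }) <|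
        load Memory.forget <| goto fun _ => .scan)
  | .scan =>
    pop .rows (fun v a => { v with symbol := a }) <|
    branch (fun v => v.symbol.isSome)
      (push .rowsDone Memory.theSymbol <|
        branch (fun v => decide (v.symbol = some .comma))
          (load Memory.forget <| goto fun _ => .back)
          (pop .cells (fun v c => v.read v.bit (c.getD ⟨.unseen, false, false, false⟩)) <|
            push .cellsDone Memory.theCell <| load Memory.forget <| goto fun _ => .scan))
      (branch Memory.changed
        (load (fun _ => Memory.initial) <| goto fun _ => .rewind)
        (load (fun _ => Memory.initial) <| goto fun _ => .clear))
  | .back =>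
    pop .cellsDone (fun v c => { v with cell := c }) <|
    branch (fun v => v.cell.isSome)
      (push .cells Memory.write <| load Memory.forget <| goto fun _ => .back)
      (load Memory.finish <| goto fun _ => .scan)
  | .clear =>
    pop .rowsDone (fun v a => { v with symbol := a }) <|
    branch (fun v => v.symbol.isSome)
      (load Memory.forget <| goto fun _ => .clear)
      (load Memory.forget <| goto fun _ => .reverse)
  | .reverse =>
    pop .cells (fun v c => { v with cell := c }) <|
    branch (fun v => v.cell.isSome)
      (push .cellsDone Memory.theCell <| load Memory.forget <| goto fun _ => .reverse)
      (load Memory.forget <| goto fun _ => .output)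
  | .output =>
    pop .cellsDone (fun v c => { v with cell := c }) <|
    branch (fun v => v.cell.isSome)
      (push .out (fun v => decide (v.theCell.mark = .tail)) <|
        load Memory.forget <| goto fun _ => .output)
      (load Memory.forget <| halt)

/-- The contents of the stacks. -/
def contents (a b : List Γ') (x y : List Cell) (o : List Bool) : ∀ k : Stack, List k.Symbol
  | .rows => a
  | .rowsDone => b
  | .cells => x
  | .cellsDone => y
  | .out => o

/-- The configurations of the machine. -/
abbrev Config := TM2.Cfg Stack.Symbol Label Memory

/-- The configuration with label `l`, memory `v` and the given stacks. -/
abbrev config (l : Label) (v : Memory) (a b : List Γ') (x y : List Cell) (o : List Bool) :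
    Config := ⟨some l, v, contents a b x y o⟩

section Update

variable (a b a' : List Γ') (x y x' : List Cell) (o o' : List Bool)

@[simp] theorem update_rows :
    Function.update (contents a b x y o) .rows a' = contents a' b x y o := by
  funext k; cases k <;> simp [contents, Function.update]

@[simp] theorem update_rowsDone :
    Function.update (contents a b x y o) .rowsDone a' = contents a a' x y o := by
  funext k; cases k <;> simp [contents, Function.update]

@[simp] theorem update_cells :
    Function.update (contents a b x y o) .cells x' = contents a b x' y o := by
  funext k; cases k <;> simp [contents, Function.update]

@[simp] theorem update_cellsDone :
    Function.update (contents a b x y o) .cellsDone x' = contents a b x x' o := by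
  funext k; cases k <;> simp [contents, Function.update]

@[simp] theorem update_out :
    Function.update (contents a b x y o) .out o' = contents a b x y o' := by
  funext k; cases k <;> simp [contents, Function.update]

@[simp] theorem contents_rows : contents a b x y o .rows = a := rfl
@[simp] theorem contents_rowsDone : contents a b x y o .rowsDone = b := rfl
@[simp] theorem contents_cells : contents a b x y o .cells = x := rfl
@[simp] theorem contents_cellsDone : contents a b x y o .cellsDone = y := rfl
@[simp] theorem contents_out : contents a b x y o .out = o := rfl

end Update

/-- The machine gets from `c` to `c'` in at most `m` steps. -/
def RunsIn (m : ℕ) (c c' : Config) : Prop :=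
  Nonempty (StateTransition.EvalsToInTime (TM2.step program) c (some c') m)

namespace RunsIn

theorem refl (c : Config) : RunsIn 0 c c := ⟨.refl _ _⟩

theorem trans {m₁ m₂ : ℕ} {c₁ c₂ c₃ : Config} (h₁ : RunsIn m₁ c₁ c₂) (h₂ : RunsIn m₂ c₂ c₃) :
    RunsIn (m₁ + m₂) c₁ c₃ := by
  obtain ⟨e₁⟩ := h₁
  obtain ⟨e₂⟩ := h₂
  rw [add_comm]
  exact ⟨.trans _ _ _ _ _ _ e₁ e₂⟩

theorem mono {m m' : ℕ} {c c' : Config} (h : RunsIn m c c') (hm : m ≤ m') : RunsIn m' c c' := by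
  obtain ⟨e⟩ := h
  exact ⟨⟨e.toEvalsTo, e.steps_le_m.trans hm⟩⟩

theorem step {c c' : Config} (h : TM2.step program c = some c') : RunsIn 1 c c' :=
  ⟨⟨⟨1, h⟩, le_rfl⟩⟩

theorem head {m : ℕ} {c c' c'' : Config} (h : TM2.step program c = some c')
    (h' : RunsIn m c' c'') : RunsIn (m + 1) c c'' :=
  ((step h).trans h').mono (by omega)

end RunsIn

/-! ### Running times of the simple loops. -/

section Loops

variable (a b : List Γ') (x y : List Cell) (o : List Bool)

theorem runsIn_rewind (c : Cell) :
    RunsIn (b.length + 1) (config .rewind .initial a b (c :: x) y o)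
      (config .scan .initial (b.reverse ++ a) [] ({ c with here := true } :: x) y o) := by
  induction b generalizing a with
  | nil =>
    refine .step ?_
    simp [program, Memory.forget, Memory.initial, Memory.theCell]
  | cons d b ih =>
    refine .head (c' := config .rewind .initial (d :: a) b (c :: x) y o) ?_ ?_
    · simp [program, Memory.forget, Memory.initial, Memory.theSymbol]
    · simpa using ih (d :: a)

theorem runsIn_clear :
    RunsIn (b.length + 1) (config .clear .initial a b x y o)
      (config .reverse .initial a [] x y o) := by
  induction b with
  | nil =>
    refine .step ?_
    simp [program, Memory.forget, Memory.initial]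
  | cons d b ih =>
    refine .head (c' := config .clear .initial a b x y o) ?_ ih
    simp [program, Memory.forget, Memory.initial]

/-- The output loop reverses the order once more, so that vertex `0` ends up on top of the output.
-/
theorem runsIn_reverse :
    RunsIn (x.length + 1) (config .reverse .initial a b x y o)
      (config .output .initial a b [] (x.reverse ++ y) o) := by
  induction x generalizing y with
  | nil =>
    refine .step ?_
    simp [program, Memory.forget, Memory.initial]
  | cons d x ih =>
    refine .head (c' := config .reverse .initial a b x (d :: y) o) ?_ ?_
    · simp [program, Memory.forget, Memory.initial, Memory.theCell]
    · simpa using ih (d :: y)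

theorem runsIn_output :
    RunsIn (y.length + 1) (config .output .initial a b x y o)
      ⟨none, .initial, contents a b x [] ((y.map fun c => decide (c.mark = .tail)).reverse ++ o)⟩ := by
  induction y generalizing o with
  | nil =>
    refine .step ?_
    simp [program, Memory.forget, Memory.initial]
  | cons d y ih =>
    refine .head (c' := config .output .initial a b x y (decide (d.mark = .tail) :: o)) ?_ ?_
    · simp [program, Memory.forget, Memory.initial, Memory.theCell]
      rfl
    · simpa using ih (decide (d.mark = .tail) :: o)

/-- The first row supplies the number of vertices: one blank entry is created for each bit before
the separator. -/
theorem runsIn_start (l : List Bool) :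
    RunsIn (l.length + 1) (config .start .initial (l.map Γ'.bit ++ .comma :: a) b x y o)
      (config .rewind .initial a (.comma :: ((l.map Γ'.bit).reverse ++ b))
        (List.replicate l.length ⟨.unseen, false, false, false⟩ ++ x) y o) := by
  induction l generalizing b x with
  | nil =>
    refine .step ?_
    simp [program, Memory.initial, Memory.theSymbol]
  | cons d l ih =>
    refine .head (c' := config .start .initial (l.map Γ'.bit ++ .comma :: a) (.bit d :: b)
      (⟨.unseen, false, false, false⟩ :: x) y o) ?_ ?_
    · simp [program, Memory.initial, Memory.theSymbol]
    · have := ih (.bit d :: b) (⟨.unseen, false, false, false⟩ :: x)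
      simpa [List.replicate_succ', List.append_assoc] using this

end Loops

/-! ### Scanning one row and updating the marks. -/

section Row

variable (adj : ℕ → ℕ → Bool) (s : ℕ → Mark) (n i : ℕ)

/-- The entry of vertex `j` before it is read in the scan of row `i`. -/
def cellAhead (j : ℕ) : Cell := ⟨s j, decide (j = i), false, false⟩

/-- The entry of vertex `j` after it has been read in the scan of row `i`. -/
def cellBehind (j : ℕ) : Cell :=
  ⟨s j, decide (j = i), decide (j = i + 1), firstOpenNbr adj s i j⟩

/-- The memory after `p` entries of row `i` have been read. -/
def scanMemory (changed : Bool) (p : ℕ) : Memory where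
  symbol := none
  cell := none
  mark := if i < p then s i else .unseen
  unseen := unseenCount adj s p i
  opens := openCount adj s p i
  carry := decide (p = i + 1)
  changed := changed

theorem scanMemory_zero (changed : Bool) :
    scanMemory adj s i changed 0 = { Memory.initial with changed := changed } := by
  simp [scanMemory, Memory.initial, unseenCount, openCount, Count.cap]

theorem unseenCount_succ (p : ℕ) : unseenCount adj s (p + 1) i =
    if unseenNbr adj s i p then (unseenCount adj s p i).succ else unseenCount adj s p i := by
  rw [unseenCount, unseenCount, Nat.count_succ, Count.succ_cap]
  split_ifs <;> rfl

theorem openCount_succ (p : ℕ) : openCount adj s (p + 1) i =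
    if openNbr adj s i p then (openCount adj s p i).succ else openCount adj s p i := by
  rw [openCount, openCount, Nat.count_succ, Count.succ_cap]
  split_ifs <;> rfl

/-- The flag `first` is computed from the counter before its increment, so only the first open
neighbour gets it. The bit `carry` tells that the preceding entry was that of `i`, which singles out
vertex `i + 1`. -/
theorem read_scanMemory (changed : Bool) (p : ℕ) (a : Option Γ') :
    ({ scanMemory adj s i changed p with symbol := a }).read (adj i p) (cellAhead s i p) =
      { scanMemory adj s i changed (p + 1) with
        symbol := a, cell := some (cellBehind adj s i p) } := by
  simp only [Memory.read, scanMemory, cellAhead, cellBehind, unseenCount_succ, openCount_succ,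
    Memory.mk.injEq, true_and, and_true]
  refine ⟨rfl, ?_, rfl, rfl, by simp⟩
  by_cases h : p = i
  · simp [h]
  · have : i < p + 1 ↔ i < p := by omega
    simp only [h, this, decide_false, Bool.false_eq_true, if_false]

variable (a b : List Γ') (x y : List Cell) (o : List Bool)

theorem runsIn_scan (changed : Bool) (m p : ℕ) :
    RunsIn (m + 1)
      (config .scan (scanMemory adj s i changed p)
        ((List.range' p m).map (fun j => .bit (adj i j)) ++ .comma :: a) b
        ((List.range' p m).map (cellAhead s i) ++ x) y o)
      (config .back (scanMemory adj s i changed (p + m)) a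
        (.comma :: (((List.range' p m).map fun j => .bit (adj i j)).reverse ++ b)) x
        (((List.range' p m).map (cellBehind adj s i)).reverse ++ y) o) := by
  induction m generalizing p b y with
  | zero =>
    refine .step ?_
    simp [program, Memory.forget, Memory.theSymbol, scanMemory]
  | succ m ih =>
    refine .head (c' := config .scan (scanMemory adj s i changed (p + 1))
        ((List.range' (p + 1) m).map (fun j => .bit (adj i j)) ++ .comma :: a)
        (.bit (adj i p) :: b)
        ((List.range' (p + 1) m).map (cellAhead s i) ++ x) (cellBehind adj s i p :: y) o) ?_ ?_
    · have hr := read_scanMemory adj s i changed p (some (.bit (adj i p)))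
      simp only [scanMemory] at hr
      simp [program, List.range'_succ, hr, Memory.bit, Memory.forget, Memory.theSymbol,
        Memory.theCell, scanMemory]
    · have := ih (.bit (adj i p) :: b) (cellBehind adj s i p :: y) (p + 1)
      simpa [List.range'_succ, show p + 1 + m = p + (m + 1) by omega] using this

/-- As `i < n`, the mark of `i` is in memory once the whole row has been read, and the counters are
complete. Replacing `here` by `succ` moves the marker on to the next vertex. -/
theorem write_scanMemory (changed : Bool) (hi : i < n) (j : ℕ) :
    ({ scanMemory adj s i changed n with cell := some (cellBehind adj s i j) } : Memory).write =
      cellAhead (sweepRow adj s n i) (i + 1) j := by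
  simp only [Memory.write, Memory.theCell, scanMemory, cellBehind, cellAhead, sweepRow, hi,
    Option.getD_some, if_true, decide_eq_true_iff]

theorem runsIn_back (changed : Bool) (hi : i < n) (p : ℕ) :
    RunsIn (p + 1)
      (config .back (scanMemory adj s i changed n) a b x
        ((List.range p).map (cellBehind adj s i)).reverse o)
      (config .scan { Memory.initial with
          changed := changed || (s i).changes (unseenCount adj s n i) } a b
        ((List.range p).map (cellAhead (sweepRow adj s n i) (i + 1)) ++ x) [] o) := by
  induction p generalizing x with
  | zero =>
    refine .step ?_
    simp [program, Memory.finish, scanMemory, hi]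
  | succ p ih =>
    refine .head (c' := config .back (scanMemory adj s i changed n) a b
        (cellAhead (sweepRow adj s n i) (i + 1) p :: x)
        ((List.range p).map (cellBehind adj s i)).reverse o) ?_ ?_
    · simp [program, List.range_succ, write_scanMemory, hi, Memory.forget]
      rfl
    · simpa [List.range_succ] using ih (cellAhead (sweepRow adj s n i) (i + 1) p :: x)

/-- Row `i` of the matrix as a word. -/
def rowWord : List Γ' := (List.range n).map (fun j => .bit (adj i j)) ++ [.comma]

theorem runsIn_row (changed : Bool) (hi : i < n) :
    RunsIn (2 * n + 2)
      (config .scan { Memory.initial with changed := changed } (rowWord adj n i ++ a) b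
        ((List.range n).map (cellAhead s i)) [] o)
      (config .scan { Memory.initial with
          changed := changed || (s i).changes (unseenCount adj s n i) } a
        ((rowWord adj n i).reverse ++ b)
        ((List.range n).map (cellAhead (sweepRow adj s n i) (i + 1))) [] o) := by
  have h1 := runsIn_scan adj s i a b [] [] o changed n 0
  have h2 := runsIn_back adj s n i a (.comma ::
    (((List.range' 0 n).map fun j => .bit (adj i j)).reverse ++ b)) [] o changed hi n
  rw [scanMemory_zero] at h1
  simp only [← List.range_eq_range', zero_add, List.append_nil] at h1 h2
  have h3 := (h1.trans h2).mono (m' := 2 * n + 2) (by omega)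
  simpa [rowWord] using h3

end Row


/-! ### Passes through the matrix and the total running time. -/

section Run

variable {n : ℕ} {G : Digraph (Fin n)} {adj : ℕ → ℕ → Bool} {s : ℕ → Mark}

/-- Rows `i` to `i + m - 1` of the matrix as a word. -/
def rowsWord (adj : ℕ → ℕ → Bool) (n i m : ℕ) : List Γ' :=
  (List.range' i m).flatMap (rowWord adj n)

theorem length_rowsWord (adj : ℕ → ℕ → Bool) (n i m : ℕ) :
    (rowsWord adj n i m).length = m * (n + 1) := by
  simp [rowsWord, List.length_flatMap, rowWord]

/-- In the alternative without change the marks are the same throughout, so all rows have been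
tested against the final marks. -/
theorem runsIn_rows (hadj : ∀ u v : Fin n, adj u v ↔ G.Adj u v) (m i : ℕ) (hi : i + m ≤ n)
    (hs : ∃ t N, EliminationInvariant G (fun v : Fin n => s v) t N)
    (a b : List Γ') (o : List Bool) (changed : Bool) :
    ∃ s' changed', (∃ t N, EliminationInvariant G (fun v : Fin n => s' v) t N) ∧
      RunsIn (m * (2 * n + 2))
        (config .scan { Memory.initial with changed := changed } (rowsWord adj n i m ++ a) b
          ((List.range n).map (cellAhead s i)) [] o)
        (config .scan { Memory.initial with changed := changed' } a
          ((rowsWord adj n i m).reverse ++ b) ((List.range n).map (cellAhead s' (i + m))) [] o) ∧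
      (changed' = changed ∧ s' = s ∧
          (∀ j, i ≤ j → j < i + m → (s j).changes (unseenCount adj s n j) = false) ∨
        changed' = true ∧ totalWeight s' n < totalWeight s n) := by
  induction m generalizing i s b changed with
  | zero =>
    refine ⟨s, changed, hs, ?_, Or.inl ⟨rfl, rfl, fun j h1 h2 => by omega⟩⟩
    simpa [rowsWord] using RunsIn.refl _
  | succ m ih =>
    have hin : i < n := by omega
    have hrow := runsIn_row adj s n i (rowsWord adj n (i + 1) m ++ a) b o changed hin
    have hs₁ : ∃ t N, EliminationInvariant G (fun v : Fin n => sweepRow adj s n i v) t N := by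
      by_cases hc : (s i).changes (unseenCount adj s n i) = true
      · obtain ⟨t, N, h⟩ := hs
        exact h.step (h.eliminationStep_sweepRow hadj ⟨i, hin⟩ hc)
      · rwa [sweepRow_eq_self (by simpa using hc)]
    obtain ⟨s', changed', h1, h2, h3⟩ := ih (i := i + 1) (s := sweepRow adj s n i)
      (b := (rowWord adj n i).reverse ++ b)
      (changed := changed || (s i).changes (unseenCount adj s n i)) (by omega) hs₁
    refine ⟨s', changed', h1, ?_, ?_⟩
    · have h4 := (hrow.trans h2).mono (m' := (m + 1) * (2 * n + 2)) (by
        rw [Nat.add_one_mul m]; omega)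
      have e : i + 1 + m = i + (m + 1) := by omega
      simpa [rowsWord, List.range'_succ, List.append_assoc, e] using h4
    · by_cases hc : (s i).changes (unseenCount adj s n i) = true
      · have hlt := totalWeight_sweepRow_lt hin hc
        refine Or.inr ?_
        rcases h3 with ⟨h4, h5, _⟩ | ⟨h4, h5⟩
        · exact ⟨by rw [h4, hc, Bool.or_true], h5 ▸ hlt⟩
        · exact ⟨h4, h5.trans hlt⟩
      · rw [Bool.not_eq_true] at hc
        rw [sweepRow_eq_self hc, hc, Bool.or_false] at h3
        refine h3.imp (fun ⟨h4, h5, h6⟩ => ⟨h4, h5, fun j hj1 hj2 => ?_⟩) id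
        rcases hj1.eq_or_lt with rfl | hj
        · exact hc
        · exact h6 j hj (by omega)

/-- After the last row the marker has left the vector, and no entry is marked; rewinding marks
vertex `0`, which exists because `0 < n`. -/
theorem runsIn_rewind_cells (hn : 0 < n) (s : ℕ → Mark) (a b : List Γ') (y : List Cell)
    (o : List Bool) :
    RunsIn (b.length + 1) (config .rewind .initial a b ((List.range n).map (cellAhead s n)) y o)
      (config .scan .initial (b.reverse ++ a) [] ((List.range n).map (cellAhead s 0)) y o) := by
  obtain ⟨k, rfl⟩ : ∃ k, n = k + 1 := ⟨n - 1, by omega⟩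
  have h := runsIn_rewind a b ((List.range k).map fun j => cellAhead s 0 (j + 1)) y o
    (cellAhead s (k + 1) 0)
  have e : (List.range k).map (fun j => cellAhead s (k + 1) (j + 1)) =
      (List.range k).map fun j => cellAhead s 0 (j + 1) := by
    refine List.map_congr_left fun j hj => ?_
    have := List.mem_range.1 hj
    simp only [cellAhead, Cell.mk.injEq, true_and, and_true]
    rw [decide_eq_decide]
    omega
  simp only [List.range_succ_eq_map, List.map_cons, List.map_map, Function.comp_def,
    Nat.succ_eq_add_one, e]
  simpa [cellAhead] using h

/-- Induction on the weight. A pass takes `2 * (n * (n + 1))` steps; starting the next one takes `n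
* (n + 1) + 2` more. The extra pass in `w + 1` is the one that finds no change. -/
theorem runsIn_passes (hn : 0 < n) (hadj : ∀ u v : Fin n, adj u v ↔ G.Adj u v) (w : ℕ)
    (hw : totalWeight s n = w)
    (hs : ∃ t N, EliminationInvariant G (fun v : Fin n => s v) t N) :
    ∃ s' : ℕ → Mark, (∃ t N, EliminationInvariant G (fun v : Fin n => s' v) t N) ∧
      (∀ i < n, (s' i).changes (unseenCount adj s' n i) = false) ∧
      RunsIn ((w + 1) * (3 * (n * (n + 1)) + 2))
        (config .scan .initial (rowsWord adj n 0 n) [] ((List.range n).map (cellAhead s 0)) [] [])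
        (config .clear .initial [] (rowsWord adj n 0 n).reverse
          ((List.range n).map (cellAhead s' n)) [] []) := by
  induction w using Nat.strong_induction_on generalizing s with
  | _ w ih =>
    obtain ⟨s₁, changed, h1, h2, h3⟩ := runsIn_rows hadj n 0 (by omega) hs [] [] [] false
    simp only [List.append_nil, zero_add] at h2 h3
    have e : n * (2 * n + 2) = 2 * (n * (n + 1)) := by ring
    rcases h3 with ⟨rfl, rfl, h3⟩ | ⟨rfl, h3⟩
    · refine ⟨s₁, h1, fun i hi => h3 i (Nat.zero_le _) hi, ?_⟩
      refine (h2.trans (RunsIn.step (c' := config .clear .initial [] (rowsWord adj n 0 n).reverse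
          ((List.range n).map (cellAhead s₁ n)) [] []) ?_)).mono ?_
      · simp [program, Memory.initial]
      · rw [Nat.add_one_mul w, e]
        omega
    · obtain ⟨s', h4, h5, h6⟩ := ih (totalWeight s₁ n) (hw ▸ h3) rfl h1
      refine ⟨s', h4, h5, ?_⟩
      have h7 := runsIn_rewind_cells hn s₁ [] (rowsWord adj n 0 n).reverse [] []
      rw [List.reverse_reverse, List.append_nil, List.length_reverse, length_rowsWord] at h7
      refine (h2.trans (RunsIn.head ?_ (h7.trans h6))).mono ?_
      · simp [program, Memory.initial]
      · have : totalWeight s₁ n + 1 ≤ w := hw ▸ h3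
        have := Nat.mul_le_mul_right (3 * (n * (n + 1)) + 2) this
        rw [Nat.add_one_mul w, e]
        omega

/-- Besides the passes, with initial weight `3 * n`, there are `n + 1` steps for the first row, `n +
2` for rewinding it, `n * (n + 1) + 1` for clearing the matrix, and `n + 1` each for reversing and
for the output. -/
theorem runsIn_program (hn : 0 < n) (hG : ∀ u v, Nbr G u v → Nbr G v u)
    (hadj : ∀ u v : Fin n, adj u v ↔ G.Adj u v) :
    ∃ s' : ℕ → Mark, (∃ t N, EliminationInvariant G (fun v : Fin n => s' v) t N) ∧
      (∀ i < n, (s' i).changes (unseenCount adj s' n i) = false) ∧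
      RunsIn ((3 * n + 1) * (3 * (n * (n + 1)) + 2) + 2 * (n * (n + 1)) + 4 * n + 6)
        (config .start .initial (rowsWord adj n 0 n) [] [] [] [])
        ⟨none, .initial, contents [] [] [] []
          ((List.range n).map fun j => decide (s' j = .tail))⟩ := by
  obtain ⟨s', h1, h2, h3⟩ := runsIn_passes hn hadj _ rfl ⟨_, _, eliminationInvariant_unseen hG⟩
    (s := fun _ => .unseen)
  refine ⟨s', h1, h2, ?_⟩
  have e₀ : rowsWord adj n 0 n = ((List.range n).map (adj 0)).map Γ'.bit ++
      .comma :: rowsWord adj n 1 (n - 1) := by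
    obtain ⟨k, rfl⟩ : ∃ k, n = k + 1 := ⟨n - 1, by omega⟩
    simp [rowsWord, List.range'_succ, rowWord]
  have e₁ : List.replicate n (⟨.unseen, false, false, false⟩ : Cell) =
      (List.range n).map (cellAhead (fun _ => .unseen) n) := by
    symm
    rw [List.eq_replicate_iff]
    refine ⟨by simp, fun c hc => ?_⟩
    obtain ⟨j, hj, rfl⟩ := List.mem_map.1 hc
    have := List.mem_range.1 hj
    simp [cellAhead, this.ne]
  have r₁ := runsIn_start (rowsWord adj n 1 (n - 1)) [] [] [] [] ((List.range n).map (adj 0))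
  rw [← e₀] at r₁
  simp only [List.length_map, List.length_range, List.append_nil, e₁] at r₁
  have r₂ := runsIn_rewind_cells hn (fun _ => .unseen) (rowsWord adj n 1 (n - 1))
    (.comma :: (((List.range n).map (adj 0)).map Γ'.bit).reverse) [] []
  rw [List.reverse_cons, List.reverse_reverse, List.append_assoc, List.singleton_append,
    ← e₀] at r₂
  have r₄ := runsIn_clear [] (rowsWord adj n 0 n).reverse ((List.range n).map (cellAhead s' n)) [] []
  have r₅ := runsIn_reverse [] [] ((List.range n).map (cellAhead s' n)) [] []
  have r₆ := runsIn_output [] [] [] ((List.range n).map (cellAhead s' n)).reverse []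
  rw [List.append_nil] at r₅
  have r := r₁.trans (r₂.trans (h3.trans (r₄.trans (r₅.trans r₆))))
  have e₂ : ((List.range n).map (cellAhead s' n)).map (fun c => decide (c.mark = .tail)) =
      (List.range n).map fun j => decide (s' j = .tail) := by
    rw [List.map_map]
    rfl
  rw [List.map_reverse, List.reverse_reverse, List.append_nil, e₂] at r
  refine r.mono ?_
  rw [totalWeight_unseen]
  simp only [List.length_cons, List.length_reverse, List.length_map, List.length_range,
    length_rowsWord]
  omega

end Run

/-- The machine that computes a minimum-size input set. -/
noncomputable def machine : FinTM2 where
  K := Stack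
  k₀ := .rows
  k₁ := .out
  Γ := Stack.Symbol
  Λ := Label
  main := .start
  σ := Memory
  initialState := .initial
  Γk₀Fin := inferInstanceAs (Fintype Γ')
  m := program

theorem finite_symbol (k : Stack) : Finite k.Symbol := by
  cases k <;> dsimp only [Stack.Symbol] <;> infer_instance

theorem initList_machine (l : List Γ') :
    @Eq Config (initList machine l) (config .start .initial l [] [] [] []) := by
  unfold initList
  congr 1
  funext k
  cases k <;> rfl

theorem haltList_machine (l : List Bool) :
    @Eq Config (haltList machine l) ⟨none, .initial, contents [] [] [] [] l⟩ := by
  unfold haltList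
  congr 1
  funext k
  cases k <;> rfl

theorem map_finRange_val {α : Type*} (n : ℕ) (f : ℕ → α) :
    (List.finRange n).map (fun j : Fin n => f j) = (List.range n).map f := by
  rw [← List.map_coe_finRange_eq_range, List.map_map]
  rfl

open Classical in
/-- The adjacency matrix of `G`, continued by `false`. -/
noncomputable def adjacency {n : ℕ} (G : Digraph (Fin n)) (i j : ℕ) : Bool :=
  if h : i < n ∧ j < n then decide (G.Adj ⟨i, h.1⟩ ⟨j, h.2⟩) else false

theorem adjacency_iff {n : ℕ} (G : Digraph (Fin n)) (u v : Fin n) :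
    adjacency G u v ↔ G.Adj u v := by
  simp [adjacency]

theorem encodeDigraph_eq {n : ℕ} (G : Digraph (Fin n)) :
    encodeDigraph G = rowsWord (adjacency G) n 0 n := by
  rw [encodeDigraph, rowsWord, ← List.range_eq_range', ← List.map_coe_finRange_eq_range,
    List.flatMap_map]
  refine List.flatMap_congr fun i _ => ?_
  rw [rowWord, ← map_finRange_val]
  simp [adjacency]

end StrongControl

theorem mainTheorem5 :
    ∃ inputSet : (I : StrongControl.SelfDampedTree) → Finset (Fin I.n),
      (∀ I : StrongControl.SelfDampedTree,
        StrongControl.IsMinimumInputSet I.graph (inputSet I)) ∧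
      StrongControl.PolyTimeComputable StrongControl.encodeInstance StrongControl.encodeVertexSet
        (fun I : StrongControl.SelfDampedTree =>
          (⟨I.n, inputSet I⟩ : Σ n : ℕ, Finset (Fin n))) := by
  have hpos : ∀ I : StrongControl.SelfDampedTree, 0 < I.n := by
    intro I
    obtain ⟨T, hT, _⟩ := I.tree
    obtain ⟨v⟩ := hT.connected.nonempty
    exact v.pos
  have hsymm : ∀ (I : StrongControl.SelfDampedTree) (u v),
      StrongControl.Nbr I.graph u v → StrongControl.Nbr I.graph v u := by
    intro I u v huv
    obtain ⟨T, _, hT⟩ := I.tree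
    exact ⟨(hT v u huv.2.symm).2 ((hT u v huv.2).1 huv.1).symm, huv.2.symm⟩
  choose s hs hquiet hrun using fun I : StrongControl.SelfDampedTree =>
    StrongControl.runsIn_program (hpos I) (hsymm I) (StrongControl.adjacency_iff I.graph)
  refine ⟨fun I => Finset.univ.filter fun v : Fin I.n => s I v = .tail, fun I => ?_, ?_⟩
  · obtain ⟨t, N, h⟩ := hs I
    exact h.isMinimumInputSet I.selfDamped I.tree (StrongControl.adjacency_iff I.graph) (hquiet I)
  · refine ⟨⟨⟨StrongControl.machine, Equiv.refl _, Equiv.refl _⟩,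
      -- The variable stands for the input length `n * (n + 1)`, which also bounds `n`; so `2 * (n *
      -- (n + 1)) + 4 * n` becomes `6 * X`.
      (3 * Polynomial.X + 1) * (3 * Polynomial.X + 2) + 6 * Polynomial.X + 6,
      fun I => Classical.choice ?_⟩, fun k => ?_⟩
    · have hr := hrun I
      rw [← StrongControl.encodeDigraph_eq, ← StrongControl.initList_machine] at hr
      have hlen : (StrongControl.encodeInstance I).length = I.n * (I.n + 1) := by
        rw [StrongControl.encodeInstance, StrongControl.encodeDigraph_eq,
          StrongControl.length_rowsWord]
      have hout : StrongControl.encodeVertexSet ⟨I.n, Finset.univ.filter fun v : Fin I.n =>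
          s I v = .tail⟩ = (List.range I.n).map fun j => decide (s I j = .tail) := by
        rw [StrongControl.encodeVertexSet, ← StrongControl.map_finRange_val]
        simp
      rw [← hout, ← StrongControl.haltList_machine] at hr
      have hr' := hr.mono (m' := ((3 * Polynomial.X + 1) * (3 * Polynomial.X + 2) +
        6 * Polynomial.X + 6 : Polynomial ℕ).eval (StrongControl.encodeInstance I).length) (by
        rw [hlen]
        simp only [Polynomial.eval_add, Polynomial.eval_mul, Polynomial.eval_X,
          Polynomial.eval_one, Polynomial.eval_ofNat]
        have : I.n ≤ I.n * (I.n + 1) := Nat.le_mul_of_pos_right _ (Nat.succ_pos _)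
        have := Nat.mul_le_mul_right (3 * (I.n * (I.n + 1)) + 2)
          (show 3 * I.n + 1 ≤ 3 * (I.n * (I.n + 1)) + 1 by omega)
        omega)
      unfold Turing.TM2OutputsInTime
      have hmap : ∀ {α : Type} (l : List α), l.map (Equiv.refl α).invFun = l := fun l => l.map_id
      erw [hmap, hmap]
      exact hr'
    · exact StrongControl.finite_symbol k
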